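/- \textbf{Theorem.} $5$-opt Optimization can be solved in time $O(n^{3.5})$. Here the input consists of a complete graph $G$ on $n\ge 3$ vertices, a weight function $w:E(G)\to\mathbb{N}$, and a Hamiltonian cycle $H$ of $G$. A $5$-move is a pair $(E^-,E^+)$ of sets of exactly $5$ edges each with $E^-\subseteq E(H)$, $E^+\subseteq E(G)$, such that $(E(H)\setminus E^-)\cup E^+$ is the edge set of a Hamiltonian cycle of $G$; its gain is $w(E^-)-w(E^+)$. $5$-opt Optimization asks for a $5$-move of maximum gain, or for the answer that there is no $5$-move (which is the case only for $n<5$). Precisely: there is a single program for the word RAM (words of $O(\log(n+W))$ bits, where $W$ is the largest edge weight; additions, subtractions, multiplications and comparisons of words and memory accesses take one step each) which, given $n$, the sequence of vertices visited by $H$, and the table of all weights in memory, outputs the edges of $E^-$ and $E^+$ for a $5$-move $(E^-,E^+)$ of maximum gain, or reports that there is none, after at most $t(n)$ steps, where $t(n)=O(n^{3.5})$ does not depend on the weights. -/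

import Mathlib

open Filter Asymptotics

/-! ### Tours, moves and gains -/

namespace KOpt

/-- An instance of `k`-opt Optimization with `n` vertices: a weight function on the edges of the
complete graph with vertex set `Fin n`, and a Hamiltonian cycle of that graph, given as the sequence
`tour 0, tour 1, …, tour (n - 1)` of its subsequent vertices (it closes up from `tour (n - 1)` to
`tour 0`). The values of `weight` at loops play no role. -/
structure Instance (n : ℕ) where
  weight : Sym2 (Fin n) → ℕ
  tour : Equiv.Perm (Fin n)

variable {n : ℕ}

/-- The edges `{w₁,w₂}, …, {wₙ₋₁,wₙ}, {wₙ,w₁}` of the given tour. -/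
def Instance.tourEdges (I : Instance n) : Finset (Sym2 (Fin n)) :=
  Finset.univ.image fun i => s(I.tour i, I.tour (finRotate n i))

/-- `F` is the edge set of a Hamiltonian cycle of the complete graph on `Fin n`. -/
def IsHamiltonianCycleEdgeSet (F : Finset (Sym2 (Fin n))) : Prop :=
  ∃ (v : Fin n) (p : (⊤ : SimpleGraph (Fin n)).Walk v v),
    p.IsHamiltonianCycle ∧ p.edges.toFinset = F

/-- `(R, A)` is a `k`-move: the `k` edges `R` are removed from the tour, the `k` edges `A` are
added, and the result is again a Hamiltonian cycle. -/
structure Instance.IsMove (I : Instance n) (k : ℕ) (R A : Finset (Sym2 (Fin n))) : Prop where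
  card_removed : R.card = k
  card_added : A.card = k
  removed_subset : R ⊆ I.tourEdges
  added_subset : A ⊆ (⊤ : SimpleGraph (Fin n)).edgeFinset
  hamiltonian : IsHamiltonianCycleEdgeSet ((I.tourEdges \ R) ∪ A)

/-- The gain `w(R) - w(A)`. -/
def Instance.gain (I : Instance n) (R A : Finset (Sym2 (Fin n))) : ℤ :=
  (∑ e ∈ R, (I.weight e : ℤ)) - ∑ e ∈ A, (I.weight e : ℤ)

/-- `(R, A)` is a `k`-move of maximum gain. -/
def Instance.IsOptimalMove (I : Instance n) (k : ℕ) (R A : Finset (Sym2 (Fin n))) : Prop :=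
  I.IsMove k R A ∧ ∀ R' A', I.IsMove k R' A' → I.gain R' A' ≤ I.gain R A

/-- The largest weight of an edge. -/
def Instance.maxWeight (I : Instance n) : ℕ :=
  (⊤ : SimpleGraph (Fin n)).edgeFinset.sup I.weight

end KOpt

/-! ### Word RAM programs with a step count -/

namespace RAM

/-- The state of the machine: registers (a program mentions only finitely many of them) and the
random access memory. -/
structure State where
  reg : ℕ → ℤ
  mem : ℕ → ℤ

/-- Arithmetic expressions; `load a` is the content of the memory cell with address `a`. -/
inductive Expr where
  | const (z : ℤ)
  | var (x : ℕ)
  | load (a : Expr)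
  | add (a b : Expr)
  | sub (a b : Expr)
  | mul (a b : Expr)

/-- The value of an expression. -/
def Expr.val (s : State) : Expr → ℤ
  | const z => z
  | var x => s.reg x
  | load a => s.mem (a.val s).toNat
  | add a b => a.val s + b.val s
  | sub a b => a.val s - b.val s
  | mul a b => a.val s * b.val s

/-- The number of elementary operations for the evaluation: one for each node. -/
def Expr.cost : Expr → ℕ
  | const _ => 1
  | var _ => 1
  | load a => a.cost + 1
  | add a b => a.cost + b.cost + 1
  | sub a b => a.cost + b.cost + 1
  | mul a b => a.cost + b.cost + 1

/-- The evaluation is legal on a machine whose words hold the integers of absolute value at most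
`B`: no constant and no intermediate result overflows, and no address is negative. -/
def Expr.Fits (B : ℕ) (s : State) : Expr → Prop
  | const z => |z| ≤ (B : ℤ)
  | var _ => True
  | load a => a.Fits B s ∧ 0 ≤ a.val s
  | add a b => a.Fits B s ∧ b.Fits B s ∧ |a.val s + b.val s| ≤ (B : ℤ)
  | sub a b => a.Fits B s ∧ b.Fits B s ∧ |a.val s - b.val s| ≤ (B : ℤ)
  | mul a b => a.Fits B s ∧ b.Fits B s ∧ |a.val s * b.val s| ≤ (B : ℤ)

/-- Programs. The tests of `ite` and `loop` compare two expressions: `ite a b p q` is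
"if `a < b` then `p` else `q`", and `loop a b p` is "while `a < b` do `p`". -/
inductive Program where
  | skip
  | assign (x : ℕ) (e : Expr)
  | store (a e : Expr)
  | seq (p q : Program)
  | ite (a b : Expr) (p q : Program)
  | loop (a b : Expr) (p : Program)

/-- `Exec B p s t s'`: on a machine with word bound `B`, the program `p`, started in state `s`,
halts in state `s'` after exactly `t` steps. There is no such `t`, `s'` when `p` does not halt,
overflows a word, or uses a negative address. -/
inductive Exec (B : ℕ) : Program → State → ℕ → State → Prop where
  | skip (s : State) : Exec B .skip s 1 s
  | assign (x : ℕ) (e : Expr) (s : State) (he : e.Fits B s) :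
      Exec B (.assign x e) s (e.cost + 1) { s with reg := Function.update s.reg x (e.val s) }
  | store (a e : Expr) (s : State) (ha : a.Fits B s) (h0 : 0 ≤ a.val s) (he : e.Fits B s) :
      Exec B (.store a e) s (a.cost + e.cost + 1)
        { s with mem := Function.update s.mem (a.val s).toNat (e.val s) }
  | seq {p q : Program} {s₁ s₂ s₃ : State} {t₁ t₂ : ℕ}
      (hp : Exec B p s₁ t₁ s₂) (hq : Exec B q s₂ t₂ s₃) : Exec B (.seq p q) s₁ (t₁ + t₂) s₃
  | ite_true {a b : Expr} {p q : Program} {s s' : State} {t : ℕ}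
      (ha : a.Fits B s) (hb : b.Fits B s) (hab : a.val s < b.val s) (hp : Exec B p s t s') :
      Exec B (.ite a b p q) s (a.cost + b.cost + 1 + t) s'
  | ite_false {a b : Expr} {p q : Program} {s s' : State} {t : ℕ}
      (ha : a.Fits B s) (hb : b.Fits B s) (hab : ¬ a.val s < b.val s) (hq : Exec B q s t s') :
      Exec B (.ite a b p q) s (a.cost + b.cost + 1 + t) s'
  | loop_true {a b : Expr} {p : Program} {s₁ s₂ s₃ : State} {t₁ t₂ : ℕ}
      (ha : a.Fits B s₁) (hb : b.Fits B s₁) (hab : a.val s₁ < b.val s₁)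
      (hp : Exec B p s₁ t₁ s₂) (hl : Exec B (.loop a b p) s₂ t₂ s₃) :
      Exec B (.loop a b p) s₁ (a.cost + b.cost + 1 + t₁ + t₂) s₃
  | loop_false {a b : Expr} {p : Program} {s : State}
      (ha : a.Fits B s) (hb : b.Fits B s) (hab : ¬ a.val s < b.val s) :
      Exec B (.loop a b p) s (a.cost + b.cost + 1) s

end RAM

/-! ### Solving `k`-opt Optimization on the RAM -/

namespace KOpt

variable {n : ℕ}

/-- The initial state. Register `0` holds `n`, cell `i < n` holds the `i`-th vertex of the tour, and
cell `n + n * u + v` holds the weight of `{u, v}` for vertices `u ≠ v`; all else is `0`. -/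
def Instance.initialState (I : Instance n) : RAM.State where
  reg x := if x = 0 then (n : ℤ) else 0
  mem a :=
    if h : a < n then ((I.tour ⟨a, h⟩ : Fin n) : ℤ)
    else if h : a - n < n * n then
      let u : Fin n := ⟨(a - n) / n, Nat.div_lt_of_lt_mul h⟩
      let v : Fin n := ⟨(a - n) % n, Nat.mod_lt _ (Nat.pos_of_mul_pos_right (Nat.zero_lt_of_lt h))⟩
      if u = v then 0 else (I.weight s(u, v) : ℤ)
    else 0

/-- Words hold `O(log (n + W))` bits, `W` being the largest weight of an edge. -/
def Instance.wordBound (I : Instance n) (c : ℕ) : ℕ :=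
  (n + I.maxWeight) ^ c

/-- The `2 * k` registers from register `r` on hold the endpoints of `k` edges, listed one edge
after the other, which make up the set `E`. -/
def HoldsEdges (s : RAM.State) (r k : ℕ) (E : Finset (Sym2 (Fin n))) : Prop :=
  ∃ u v : Fin k → Fin n,
    (∀ i : Fin k, s.reg (r + 2 * i) = (u i : ℕ) ∧ s.reg (r + 2 * i + 1) = (v i : ℕ)) ∧
    Finset.univ.image (fun i => s(u i, v i)) = E

/-- The final state answers the instance: register `0` holds `1` and the next `4 * k` registers hold
the removed and the added edges of a `k`-move of maximum gain, or register `0` holds `0` and there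
is no `k`-move at all (which happens only for `n < k`). -/
def Instance.IsAnswer (I : Instance n) (k : ℕ) (s : RAM.State) : Prop :=
  (s.reg 0 = 1 ∧ ∃ R A : Finset (Sym2 (Fin n)),
      I.IsOptimalMove k R A ∧ HoldsEdges s 1 k R ∧ HoldsEdges s (1 + 2 * k) k A) ∨
  (s.reg 0 = 0 ∧ ¬ ∃ R A : Finset (Sym2 (Fin n)), I.IsMove k R A)

/-- `k`-opt Optimization can be solved in time `O(T)`: one program, on words of `O(log (n + W))`
bits, answers all instances with `n ≥ 3` vertices, and its worst-case number `t n` of steps is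
`O(T n)`. -/
def SolvableInTime (k : ℕ) (T : ℕ → ℝ) : Prop :=
  ∃ (P : RAM.Program) (c : ℕ) (t : ℕ → ℕ),
    (fun n => (t n : ℝ)) =O[atTop] T ∧
    ∀ n : ℕ, 3 ≤ n → ∀ I : Instance n, ∃ (m : ℕ) (s : RAM.State),
      RAM.Exec (I.wordBound c) P I.initialState m s ∧ m ≤ t n ∧ I.IsAnswer k s

end KOpt

/-! The program built here runs in cubic time, which is more than enough for the exponent 7/2.

A 5-move is encoded by the increasing positions `p 0 < … < p 4` of the removed tour edges together
with a permutation `φ` of their ten ends, which says how these ends are joined by the added edges.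
Whether the result is a Hamiltonian cycle depends on `φ` alone: the five tour segments between
removed edges must become connected (`Instance.isMove_of_validPattern`,
`Instance.exists_pattern_of_isMove`). There are finitely many `φ`, independent of `n`, so it
suffices to find the best `p` for each fixed valid `φ`.

Among five linearly ordered indices there are six pairs that are not consecutive, but only five
added edges. Hence some non-consecutive pair `u`, `v` is not joined by any added edge
(`exists_separated`). Once the other three positions are fixed, the choices for `u` and `v` are
independent: no term of the gain involves both, and neither position bounds the other.

The best position for `u` is found in a table. The at most two added edges at `u` lead to at most
two other removed edges, contained in a pair `α`, `β` that avoids `v`; let `γ` be the remaining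
index. The position of `u` must lie strictly between its two neighbours in the order. At least one
of these is missing or belongs to `α`, `β`, since they cannot both be `γ` (`exists_side`). So for
fixed positions of `α` and `β` one end of the range is fixed, and scanning towards the other end
while storing every intermediate optimum answers all possible positions of the other neighbour
(`Side.IsBest.improve`). This fills a cubic table in cubic time; `v` gets its own table. Three
nested loops over the positions of `α`, `β`, `γ` then look up `u` and `v` and compare gains
(`searchBody_spec`, `searchProgram_spec`).

On the machine side, a small program logic `WP` carries the running time as the syntactic quantity
`Program.time`, so that only the loop depth, three, has to be tracked (`Program.time_le`). -/

namespace RAM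

/-! ### A program logic with a syntactic time bound -/

/-- A bound on the number of steps, valid when every loop is iterated at most `n + 1` times. -/
def Program.time (n : ℕ) : Program → ℕ
  | .skip => 1
  | .assign _ e => e.cost + 1
  | .store a e => a.cost + e.cost + 1
  | .seq p q => p.time n + q.time n
  | .ite a b p q => a.cost + b.cost + 1 + (p.time n + q.time n)
  | .loop a b p => (n + 2) * (a.cost + b.cost + 1 + p.time n)

/-- The nesting depth of the loops. -/
def Program.depth : Program → ℕ
  | .skip => 0
  | .assign _ _ => 0
  | .store _ _ => 0
  | .seq p q => max p.depth q.depth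
  | .ite _ _ p q => max p.depth q.depth
  | .loop _ _ p => p.depth + 1

/-- Every level of nesting contributes one factor `n + 2`. The constant `p.time 0` depends on the
program only, so depth 3 means cubic time. -/
theorem Program.time_le (n : ℕ) (p : Program) : p.time n ≤ p.time 0 * (n + 2) ^ p.depth := by
  have mono : ∀ {a b : ℕ}, a ≤ b → (n + 2) ^ a ≤ (n + 2) ^ b := fun h =>
    Nat.pow_le_pow_right (by omega) h
  have one : ∀ a : ℕ, 1 ≤ (n + 2) ^ a := fun a => Nat.one_le_pow _ _ (by omega)
  induction p with
  | skip => simp [time, depth]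
  | assign x e => simp [time, depth]
  | store a e => simp [time, depth]
  | seq p q hp hq =>
    simp only [time, depth, add_mul]
    exact Nat.add_le_add (hp.trans (Nat.mul_le_mul_left _ (mono (le_max_left _ _))))
      (hq.trans (Nat.mul_le_mul_left _ (mono (le_max_right _ _))))
  | ite a b p q hp hq =>
    simp only [time, depth, add_mul]
    have h1 := hp.trans (Nat.mul_le_mul_left _ (mono (le_max_left p.depth q.depth)))
    have h2 := hq.trans (Nat.mul_le_mul_left _ (mono (le_max_right p.depth q.depth)))
    have h3 := one (max p.depth q.depth)
    have h4 := Nat.le_mul_of_pos_right a.cost h3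
    have h5 := Nat.le_mul_of_pos_right b.cost h3
    omega
  | loop a b p hp =>
    simp only [time, depth, pow_succ]
    have h3 := one p.depth
    have h4 : a.cost + b.cost + 1 + p.time n ≤
        (a.cost + b.cost + 1 + p.time 0) * (n + 2) ^ p.depth := by
      rw [add_mul]
      exact Nat.add_le_add (Nat.le_mul_of_pos_right _ h3) hp
    calc (n + 2) * (a.cost + b.cost + 1 + p.time n)
        ≤ (n + 2) * ((a.cost + b.cost + 1 + p.time 0) * (n + 2) ^ p.depth) :=
          Nat.mul_le_mul_left _ h4
      _ = 1 * ((a.cost + b.cost + 1 + p.time 0) * ((n + 2) ^ p.depth * (n + 2))) := by ring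
      _ ≤ (0 + 2) * ((a.cost + b.cost + 1 + p.time 0) * ((n + 2) ^ p.depth * (n + 2))) :=
          Nat.mul_le_mul_right _ (by norm_num)
      _ = _ := by ring

/-- The program has an assignment to the register `x`. -/
def Program.Writes (x : ℕ) : Program → Prop
  | .skip => False
  | .assign y _ => x = y
  | .store _ _ => False
  | .seq p q => p.Writes x ∨ q.Writes x
  | .ite _ _ p q => p.Writes x ∨ q.Writes x
  | .loop _ _ p => p.Writes x

/-- The program has a store instruction. -/
def Program.Stores : Program → Prop
  | .skip => False
  | .assign _ _ => False
  | .store _ _ => True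
  | .seq p q => p.Stores ∨ q.Stores
  | .ite _ _ p q => p.Stores ∨ q.Stores
  | .loop _ _ p => p.Stores

/-- A syntactic frame rule: later specifications describe only what a program changes, and the rest
is recovered from its text. -/
theorem Exec.reg_eq {B : ℕ} {p : Program} {s s' : State} {m : ℕ} (h : Exec B p s m s') {x : ℕ}
    (hx : ¬ p.Writes x) : s'.reg x = s.reg x := by
  induction h with
  | skip => rfl
  | assign y e s he => exact Function.update_of_ne hx _ _
  | store => rfl
  | seq _ _ h1 h2 =>
    simp only [Program.Writes, not_or] at hx
    rw [h2 hx.2, h1 hx.1]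
  | ite_true _ _ _ _ h => exact h fun h' => hx (Or.inl h')
  | ite_false _ _ _ _ h => exact h fun h' => hx (Or.inr h')
  | loop_true _ _ _ _ _ h1 h2 => rw [h2 hx, h1 hx]
  | loop_false => rfl

theorem Exec.mem_eq {B : ℕ} {p : Program} {s s' : State} {m : ℕ} (h : Exec B p s m s')
    (hx : ¬ p.Stores) : s'.mem = s.mem := by
  induction h with
  | skip => rfl
  | assign y e s he => rfl
  | store => exact absurd trivial hx
  | seq _ _ h1 h2 =>
    simp only [Program.Stores, not_or] at hx
    rw [h2 hx.2, h1 hx.1]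
  | ite_true _ _ _ _ h => exact h fun h' => hx (Or.inl h')
  | ite_false _ _ _ _ h => exact h fun h' => hx (Or.inr h')
  | loop_true _ _ _ _ _ h1 h2 => rw [h2 hx, h1 hx]
  | loop_false => rfl

/-- The state after an assignment. -/
def State.setReg (s : State) (x : ℕ) (z : ℤ) : State :=
  { s with reg := Function.update s.reg x z }

/-- The state after a store instruction. -/
def State.setMem (s : State) (a : ℕ) (z : ℤ) : State :=
  { s with mem := Function.update s.mem a z }

@[simp] theorem State.setReg_mem (s : State) (x : ℕ) (z : ℤ) : (s.setReg x z).mem = s.mem := rfl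

@[simp] theorem State.setMem_reg (s : State) (a : ℕ) (z : ℤ) : (s.setMem a z).reg = s.reg := rfl

theorem State.setReg_reg (s : State) (x y : ℕ) (z : ℤ) :
    (s.setReg x z).reg y = if y = x then z else s.reg y := Function.update_apply ..

theorem State.setMem_mem (s : State) (a b : ℕ) (z : ℤ) :
    (s.setMem a z).mem b = if b = a then z else s.mem b := Function.update_apply ..

@[simp] theorem State.setReg_same (s : State) (x : ℕ) (z : ℤ) : (s.setReg x z).reg x = z := by
  simp [setReg_reg]

theorem State.setReg_of_ne (s : State) {x y : ℕ} (z : ℤ) (h : y ≠ x) :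
    (s.setReg x z).reg y = s.reg y := by
  simp [setReg_reg, h]

@[simp] theorem State.setMem_same (s : State) (a : ℕ) (z : ℤ) : (s.setMem a z).mem a = z := by
  simp [setMem_mem]

theorem State.setMem_of_ne (s : State) {a b : ℕ} (z : ℤ) (h : b ≠ a) :
    (s.setMem a z).mem b = s.mem b := by
  simp [setMem_mem, h]

/-- The program halts within its time bound in a state with the property `Q`. -/
def WP (n B : ℕ) (p : Program) (s : State) (Q : State → Prop) : Prop :=
  ∃ m s', Exec B p s m s' ∧ m ≤ p.time n ∧ Q s'

/-! ### Rules for total correctness within the time bound -/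

section
variable {n B : ℕ} {s : State} {Q : State → Prop}

/-- The consequence rule, with the frame conditions for registers and memory available to the new
postcondition. -/
theorem WP.mono {p : Program} {Q' : State → Prop} (h : WP n B p s Q)
    (hQ : ∀ s', Q s' → (∀ x, ¬ p.Writes x → s'.reg x = s.reg x) →
      (¬ p.Stores → s'.mem = s.mem) → Q' s') : WP n B p s Q' := by
  obtain ⟨m, s', h1, h2, h3⟩ := h
  exact ⟨m, s', h1, h2, hQ s' h3 (fun x hx => h1.reg_eq hx) fun hx => h1.mem_eq hx⟩

theorem WP.skip (h : Q s) : WP n B .skip s Q := ⟨1, s, .skip s, le_rfl, h⟩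

theorem WP.assign {x : ℕ} {e : Expr} (he : e.Fits B s) (h : Q (s.setReg x (e.val s))) :
    WP n B (.assign x e) s Q := ⟨_, _, .assign x e s he, le_rfl, h⟩

theorem WP.store {a e : Expr} (b : ℕ) (ha : a.Fits B s) (hab : a.val s = b) (he : e.Fits B s)
    (h : Q (s.setMem b (e.val s))) : WP n B (.store a e) s Q := by
  refine ⟨_, _, .store a e s ha (by omega) he, le_rfl, ?_⟩
  simpa [hab, State.setMem] using h

theorem WP.seq {p q : Program} (h : WP n B p s fun s' => WP n B q s' Q) :
    WP n B (.seq p q) s Q := by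
  obtain ⟨m, s', h1, h2, m', s'', h3, h4, h5⟩ := h
  exact ⟨_, _, .seq h1 h3, Nat.add_le_add h2 h4, h5⟩

theorem WP.ite {a b : Expr} {p q : Program} (ha : a.Fits B s) (hb : b.Fits B s)
    (hp : a.val s < b.val s → WP n B p s Q) (hq : ¬ a.val s < b.val s → WP n B q s Q) :
    WP n B (.ite a b p q) s Q := by
  by_cases h : a.val s < b.val s
  · obtain ⟨m, s', h1, h2, h3⟩ := hp h
    exact ⟨_, _, .ite_true ha hb h h1, by simp only [Program.time]; omega, h3⟩
  · obtain ⟨m, s', h1, h2, h3⟩ := hq h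
    exact ⟨_, _, .ite_false ha hb h h1, by simp only [Program.time]; omega, h3⟩

/-- The program that runs `p` with the values `0, 1, …, e - 1` in the register `x`. -/
def Program.forLoop (x : ℕ) (e : Expr) (p : Program) : Program :=
  .seq (.assign x (.const 0)) (.loop (.var x) e (.seq p (.assign x (.add (.var x) (.const 1)))))

/-- The invariant is asserted after the counter has been updated. With `N ≤ n + 1` there are at most
`n + 2` tests, the final failing one included; this is the factor in `Program.time`. The condition
`N + 1 ≤ B` keeps the counter and the constant 1 within a word. -/
theorem WP.forLoop {x : ℕ} {e : Expr} {p : Program} (N : ℕ) (I : ℕ → State → Prop)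
    (hN : N ≤ n + 1) (hB : N + 1 ≤ B) (hx : ¬ p.Writes x)
    (he : ∀ i, ∀ s', I i s' → e.Fits B s' ∧ e.val s' = N)
    (h0 : I 0 (s.setReg x 0))
    (hstep : ∀ i < N, ∀ s', I i s' → s'.reg x = i →
      WP n B p s' fun t => I (i + 1) (t.setReg x (i + 1 : ℕ)))
    (hQ : ∀ s', I N s' → s'.reg x = N → Q s') :
    WP n B (.forLoop x e p) s Q := by
  set body : Program := .seq p (.assign x (.add (.var x) (.const 1))) with hbody
  have key : ∀ k i, i + k = N → ∀ s', I i s' → s'.reg x = i →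
      ∃ m s'', Exec B (.loop (.var x) e body) s' m s'' ∧
        m ≤ (k + 1) * (1 + e.cost + 1) + k * (p.time n + 4) ∧ I N s'' ∧ s''.reg x = N := by
    intro k
    induction k with
    | zero =>
      intro i hi s' hI hreg
      obtain rfl : i = N := by omega
      obtain ⟨h1, h2⟩ := he _ _ hI
      refine ⟨_, _, .loop_false trivial h1 ?_, ?_, hI, hreg⟩
      · simp only [Expr.val]; omega
      · simp [Expr.cost]
    | succ k ih =>
      intro i hi s' hI hreg
      obtain ⟨h1, h2⟩ := he _ _ hI
      obtain ⟨m1, t, h3, h4, h5⟩ := hstep i (by omega) s' hI hreg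
      have htx : t.reg x = i := by rw [h3.reg_eq hx, hreg]
      obtain ⟨m2, s'', h6, h7, h8⟩ := ih (i + 1) (by omega) (t.setReg x (i + 1 : ℕ)) h5 (by simp)
      have hfit : (Expr.add (.var x) (.const 1)).Fits B t := by
        refine ⟨trivial, ?_, ?_⟩
        · simp only [Expr.Fits]; rw [abs_of_nonneg (by omega)]; omega
        · simp only [Expr.val, htx]; rw [abs_of_nonneg (by omega)]; omega
      have hassign : Exec B (.assign x (.add (.var x) (.const 1))) t _
          (t.setReg x (Expr.val t (.add (.var x) (.const 1)))) := Exec.assign x _ t hfit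
      rw [show Expr.val t (.add (.var x) (.const 1)) = ((i + 1 : ℕ) : ℤ) by
        simp [Expr.val, htx]] at hassign
      refine ⟨_, _, .loop_true trivial h1 ?_ (.seq h3 hassign) h6, ?_, h8⟩
      · simp only [Expr.val]; omega
      · simp only [Expr.cost]
        calc _ ≤ 1 + e.cost + 1 + (p.time n + (1 + 1 + 1 + 1)) +
              ((k + 1) * (1 + e.cost + 1) + k * (p.time n + 4)) := by omega
          _ = _ := by ring
  refine WP.seq (WP.assign (by simp [Expr.Fits]) ?_)
  obtain ⟨m, s'', h1, h2, h3, h4⟩ := key N 0 (by omega) (s.setReg x 0) h0 (by simp)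
  refine ⟨m, s'', h1, h2.trans ?_, hQ _ h3 h4⟩
  simp only [Program.time, Expr.cost]
  calc (N + 1) * (1 + e.cost + 1) + N * (p.time n + 4)
      ≤ (n + 2) * (1 + e.cost + 1) + (n + 2) * (p.time n + 4) :=
        Nat.add_le_add (Nat.mul_le_mul_right _ (by omega)) (Nat.mul_le_mul_right _ (by omega))
    _ = _ := by ring

end

/-- Executes the programs of a list one after the other. -/
def Program.seqList : List Program → Program
  | [] => .skip
  | p :: l => .seq p (seqList l)

end RAM

namespace KOpt

/-! ### Hamiltonian cycles as connected systems of darts -/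

section
variable {n : ℕ}

/-- In a finite graph with all degrees two, the component of a vertex is traversed by a cycle;
connectedness makes this component everything. Connectedness is phrased through predicates that are
constant along edges, which is easier to transport between vertices and slots than paths. -/
theorem isHamiltonianCycleEdgeSet_of_degree_two (hn : 3 ≤ n) {F : Finset (Sym2 (Fin n))}
    (hdiag : ∀ e ∈ F, ¬ e.IsDiag)
    (hdeg : ∀ v, ((SimpleGraph.fromEdgeSet (F : Set (Sym2 (Fin n)))).neighborSet v).ncard = 2)
    (hconn : ∀ C : Fin n → Prop, (∀ a b, s(a, b) ∈ F → (C a ↔ C b)) → ∀ a b, C a → C b) :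
    IsHamiltonianCycleEdgeSet F := by
  classical
  set G := SimpleGraph.fromEdgeSet (F : Set (Sym2 (Fin n))) with hG
  have hcyc : G.IsCycles := fun v _ => hdeg v
  let v : Fin n := ⟨0, by omega⟩
  have hreach : ∀ w, G.Reachable v w := by
    intro w
    refine hconn (fun w => G.Reachable v w) ?_ v w (SimpleGraph.Reachable.refl v)
    intro a b hab
    have hne : a ≠ b := fun h => hdiag _ hab (by simpa using h)
    have hadj : G.Adj a b := by simp [hG, hab, hne]
    exact ⟨fun h => h.trans hadj.reachable, fun h => h.trans hadj.symm.reachable⟩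
  have hne : (G.neighborSet v).Nonempty := by
    rw [← Set.ncard_pos]; have := hdeg v; omega
  obtain ⟨p, hp, hverts⟩ := hcyc.exists_cycle_toSubgraph_verts_eq_connectedComponentSupp
    (c := G.connectedComponentMk v) (by simp) hne
  have hsupp : ∀ w, w ∈ p.toSubgraph.verts := by
    intro w
    rw [hverts]
    simpa using (hreach w).symm
  refine ⟨v, p.mapLe le_top, ⟨hp.mapLe le_top, ?_⟩, ?_⟩
  · refine (hp.mapLe le_top).isPath_tail.isHamiltonian_of_mem fun w => ?_
    have hw : w ∈ (p.mapLe le_top).support := by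
      simpa using hsupp w
    rw [SimpleGraph.Walk.support_tail_of_not_nil _ (hp.mapLe le_top).not_nil]
    rw [SimpleGraph.Walk.mem_support_iff] at hw
    rcases hw with rfl | hw
    · exact SimpleGraph.Walk.end_mem_tail_support (hp.mapLe le_top).not_nil
    · exact hw
  · ext e
    induction e with
    | h a b =>
    rw [List.mem_toFinset, SimpleGraph.Walk.edges_mapLe_eq_edges,
      ← SimpleGraph.Walk.adj_toSubgraph_iff_mem_edges,
      hp.adj_toSubgraph_iff_of_isCycles hcyc (hsupp a), hG, SimpleGraph.fromEdgeSet_adj]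
    refine ⟨fun h => by simpa using h.1, fun h => ⟨by simpa using h, fun hab => ?_⟩⟩
    exact hdiag _ h (by simpa using hab)

/-- The edges are a multigraph in which every vertex is the end of exactly two darts. A loop or a
pair of parallel edges would close off a component of at most two vertices, impossible for `n ≥ 3`
by connectedness. So the graph is simple with all degrees two. -/
theorem isHamiltonianCycleEdgeSet_of_darts (hn : 3 ≤ n) {X : Type*} [Fintype X] [DecidableEq X]
    (D : X × Bool → Fin n) (hfib : ∀ v, (Finset.univ.filter fun d => D d = v).card = 2)
    (hconn : ∀ C : Fin n → Prop, (∀ x, C (D (x, false)) ↔ C (D (x, true))) →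
      ∀ a b, C a → C b) :
    IsHamiltonianCycleEdgeSet (Finset.univ.image fun x => s(D (x, false), D (x, true))) := by
  classical
  have hout : ∀ a b : Fin n, ∃ c, c ≠ a ∧ c ≠ b := by
    intro a b
    have : ({a, b} : Finset (Fin n)).card < (Finset.univ : Finset (Fin n)).card := by
      have := Finset.card_le_two (a := a) (b := b)
      simp; omega
    obtain ⟨c, -, hc⟩ := Finset.exists_mem_notMem_of_card_lt_card this
    exact ⟨c, by simp_all⟩
  have hconn' : ∀ C : Fin n → Prop, (∀ x b, C (D (x, b)) → C (D (x, !b))) →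
      ∀ a b, C a → C b := by
    intro C hC
    exact hconn C fun x => ⟨fun h => by simpa using hC x false h, fun h => by simpa using hC x true h⟩
  have hstruct : ∀ v, ∃ x b y c, (x, b) ≠ (y, c) ∧
      (∀ d, D d = v ↔ d = (x, b) ∨ d = (y, c)) ∧ D (x, !b) ≠ v ∧ D (y, !c) ≠ v ∧
      D (x, !b) ≠ D (y, !c) := by
    intro v
    obtain ⟨⟨x, b⟩, ⟨y, c⟩, hne, hset⟩ := Finset.card_eq_two.mp (hfib v)
    have hv : ∀ d, D d = v ↔ d = (x, b) ∨ d = (y, c) := fun d => by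
      have := Finset.ext_iff.mp hset d
      simpa using this
    have hxy : x ≠ y := by
      rintro rfl
      have hbc : c = !b := by
        have h : b ≠ c := fun h => hne (by rw [h])
        clear * - h
        cases b <;> cases c <;> simp_all
      subst hbc
      obtain ⟨w, hw, -⟩ := hout v v
      -- A loop at `v` uses up both darts at `v`, so `{v}` would be a component.
      refine hw (hconn' (fun w => w = v) ?_ v w rfl)
      intro z e hz
      rcases (hv _).1 hz with h | h <;> obtain ⟨rfl, rfl⟩ := Prod.mk.inj h <;> simp [hv]
    have h1 : D (x, !b) ≠ v := by
      intro h
      rcases (hv _).1 h with h | h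
      · simp at h
      · exact hxy (Prod.mk.inj h).1
    have h2 : D (y, !c) ≠ v := by
      intro h
      rcases (hv _).1 h with h | h
      · exact hxy (Prod.mk.inj h).1.symm
      · simp at h
    refine ⟨x, b, y, c, hne, hv, h1, h2, ?_⟩
    intro h3
    set w := D (x, !b) with hw
    -- If the two edges at `v` were parallel, their far ends would be all the darts at `w`, and `{v,
    -- w}` would be a component.
    have hw' : ∀ d, D d = w ↔ d = (x, !b) ∨ d = (y, !c) := by
      obtain ⟨d1, d2, -, hset'⟩ := Finset.card_eq_two.mp (hfib w)
      have hsub : ({(x, !b), (y, !c)} : Finset (X × Bool)) ⊆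
          Finset.univ.filter fun d => D d = w := by
        intro d hd
        simp only [Finset.mem_insert, Finset.mem_singleton] at hd
        rcases hd with rfl | rfl
        · simp [hw]
        · exact Finset.mem_filter.2 ⟨Finset.mem_univ _, h3.symm⟩
      have hcard : ({(x, !b), (y, !c)} : Finset (X × Bool)).card = 2 :=
        Finset.card_pair fun h => hxy (Prod.mk.inj h).1
      have heq := Finset.eq_of_subset_of_card_le hsub (by rw [hfib, hcard])
      intro d
      have := Finset.ext_iff.mp heq d
      simpa using this.symm
    obtain ⟨z, hzv, hzw⟩ := hout v w
    have := hconn' (fun a => a = v ∨ a = w) ?_ v z (Or.inl rfl)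
    · rcases this with h | h
      · exact hzv h
      · exact hzw h
    · intro z e hz
      rcases hz with hz | hz
      · rcases (hv _).1 hz with h | h <;> obtain ⟨rfl, rfl⟩ := Prod.mk.inj h
        · exact Or.inr hw.symm
        · exact Or.inr h3.symm
      · rcases (hw' _).1 hz with h | h <;> obtain ⟨rfl, rfl⟩ := Prod.mk.inj h <;> simp [hv]
  have hmem : ∀ v w, (s(v, w) ∈ Finset.univ.image fun x => s(D (x, false), D (x, true))) ↔
      ∃ x b, D (x, b) = v ∧ D (x, !b) = w := by
    intro v w
    simp only [Finset.mem_image, Finset.mem_univ, true_and, Sym2.eq_iff]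
    constructor
    · rintro ⟨x, h | h⟩
      · exact ⟨x, false, by simpa using h⟩
      · exact ⟨x, true, by simpa using h.symm⟩
    · rintro ⟨x, b, h⟩
      cases b
      · exact ⟨x, Or.inl (by simpa using h)⟩
      · exact ⟨x, Or.inr (by simpa using h.symm)⟩
  have hnd : ∀ e ∈ Finset.univ.image (fun x => s(D (x, false), D (x, true))), ¬ e.IsDiag := by
    intro e he
    induction e with
    | h a b =>
    obtain ⟨x, e, rfl, rfl⟩ := (hmem a b).1 he
    obtain ⟨x', b', y', c', -, hv, h1, h2, -⟩ := hstruct (D (x, e))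
    intro hd
    rcases (hv (x, e)).1 rfl with h | h <;> obtain ⟨rfl, rfl⟩ := Prod.mk.inj h
    · exact h1 (by simpa using Eq.symm hd)
    · exact h2 (by simpa using Eq.symm hd)
  refine isHamiltonianCycleEdgeSet_of_degree_two hn hnd ?_ ?_
  · intro v
    obtain ⟨x, b, y, c, -, hv, h1, h2, h3⟩ := hstruct v
    rw [← Set.ncard_pair h3]
    congr 1
    ext w
    rw [SimpleGraph.mem_neighborSet, SimpleGraph.fromEdgeSet_adj, Finset.mem_coe, hmem]
    simp only [Set.mem_insert_iff, Set.mem_singleton_iff]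
    constructor
    · rintro ⟨⟨z, e, hz, rfl⟩, -⟩
      rcases (hv _).1 hz with h | h <;> obtain ⟨rfl, rfl⟩ := Prod.mk.inj h <;> simp
    · rintro (rfl | rfl)
      · exact ⟨⟨x, b, by simp [hv], rfl⟩, h1.symm⟩
      · exact ⟨⟨y, c, by simp [hv], rfl⟩, h2.symm⟩
  · intro C hC
    exact hconn C fun x => hC _ _ (Finset.mem_image_of_mem _ (Finset.mem_univ x))

/-! ### What a Hamiltonian edge set satisfies: no loops, `n` edges, degree two, connectedness -/

theorem IsHamiltonianCycleEdgeSet.not_isDiag {F : Finset (Sym2 (Fin n))}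
    (h : IsHamiltonianCycleEdgeSet F) : ∀ e ∈ F, ¬ e.IsDiag := by
  obtain ⟨v, p, hp, rfl⟩ := h
  intro e he
  have := p.edges_subset_edgeSet (List.mem_toFinset.1 he)
  simpa using this

theorem IsHamiltonianCycleEdgeSet.card_eq {F : Finset (Sym2 (Fin n))}
    (h : IsHamiltonianCycleEdgeSet F) : F.card = n := by
  obtain ⟨v, p, hp, rfl⟩ := h
  rw [List.toFinset_card_of_nodup hp.edges_nodup, SimpleGraph.Walk.length_edges, hp.length_eq]
  simp

theorem IsHamiltonianCycleEdgeSet.card_incident {F : Finset (Sym2 (Fin n))}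
    (h : IsHamiltonianCycleEdgeSet F) (v : Fin n) : (F.filter fun e => v ∈ e).card = 2 := by
  obtain ⟨u, p, hp, rfl⟩ := h
  have h2 := hp.isCycle.ncard_neighborSet_toSubgraph_eq_two (hp.mem_support v)
  have hinj : Function.Injective fun w : Fin n => s(v, w) := fun a b hab =>
    Sym2.congr_right.1 hab
  rw [← Set.ncard_image_of_injective _ hinj] at h2
  rw [← h2, ← Set.ncard_coe_finset]
  congr 1
  ext e
  simp only [Finset.coe_filter, List.mem_toFinset, Set.mem_ofPred_eq, Set.mem_image,
    SimpleGraph.Subgraph.mem_neighborSet, SimpleGraph.Walk.adj_toSubgraph_iff_mem_edges]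
  constructor
  · rintro ⟨he, w, rfl⟩
    exact ⟨w, he, rfl⟩
  · rintro ⟨w, he, rfl⟩
    exact ⟨he, by simp⟩

theorem IsHamiltonianCycleEdgeSet.connected {F : Finset (Sym2 (Fin n))}
    (h : IsHamiltonianCycleEdgeSet F) (C : Fin n → Prop)
    (hC : ∀ a b, s(a, b) ∈ F → (C a ↔ C b)) (a b : Fin n) : C a → C b := by
  obtain ⟨u, p, hp, rfl⟩ := h
  have key : ∀ {x y : Fin n} (q : (⊤ : SimpleGraph (Fin n)).Walk x y),
      (∀ e ∈ q.edges, e ∈ p.edges) → ∀ z ∈ q.support, (C x ↔ C z) := by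
    intro x y q
    induction q with
    | nil =>
      intro _ z hz
      simp at hz
      rw [hz]
    | cons hadj q ih =>
      intro hq z hz
      rw [SimpleGraph.Walk.support_cons, List.mem_cons] at hz
      rcases hz with rfl | hz
      · rfl
      · refine (hC _ _ (List.mem_toFinset.2 (hq _ (List.mem_cons_self ..)))).trans ?_
        exact ih (fun e he => hq e (by simp [he])) z hz
  have h := fun z => key p (fun _ h => h) z (hp.mem_support z)
  exact fun ha => (h b).1 ((h a).2 ha)

/-- Glue bijections between the fibres. This turns equality of the degrees in removed and added
edges into a permutation of slots. -/
theorem exists_equiv_of_card_fiber_eq {X Y W : Type*} [Fintype X] [Fintype Y] [DecidableEq W]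
    (D : X → W) (E : Y → W)
    (h : ∀ v, (Finset.univ.filter fun x => D x = v).card = (Finset.univ.filter fun y => E y = v).card) :
    ∃ e : X ≃ Y, ∀ x, E (e x) = D x := by
  have h' : ∀ v, Nonempty ({x // D x = v} ≃ {y // E y = v}) := fun v =>
    Fintype.card_eq.1 (by rw [Fintype.card_subtype, Fintype.card_subtype, h v])
  let g : ∀ v, {x // D x = v} ≃ {y // E y = v} := fun v => (h' v).some
  refine ⟨(Equiv.sigmaFiberEquiv D).symm.trans
    ((Equiv.sigmaCongrRight g).trans (Equiv.sigmaFiberEquiv E)), fun x => ?_⟩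
  exact (g (D x) ⟨x, rfl⟩).2

end

end KOpt

namespace KOpt

/-! ### Moves as patterns of reconnection -/

/-- The ends of the removed edges: `(i, false)` and `(i, true)` are the first and the second end of
the `i`-th removed edge in the order of the tour. -/
abbrev Slot := Fin 5 × Bool

/-- A way to reconnect the ends of five removed edges: the `k`-th added edge joins the ends
`φ (k, false)` and `φ (k, true)`. It is valid when the five segments of the tour between removed
edges become connected; the `i`-th segment leads from `(i, true)` to `(i + 1, false)`. -/
def ValidPattern (φ : Equiv.Perm Slot) : Prop :=
  ∀ C : Slot → Prop, (∀ k, C (φ (k, false)) ↔ C (φ (k, true))) →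
    (∀ i : Fin 5, C (i, true) ↔ C (i + 1, false)) → ∀ s t, C s → C t

/-! ### Segments of the tour between removed edges -/

section
variable {n : ℕ}

theorem finRotate_val (x : Fin n) :
    (finRotate n x : ℕ) = if (x : ℕ) + 1 < n then (x : ℕ) + 1 else 0 := by
  obtain ⟨m, rfl⟩ : ∃ m, n = m + 1 := ⟨n - 1, by have := x.2; omega⟩
  split_ifs with h
  · rw [coe_finRotate_of_ne_last]
    intro h'; simp [h'] at h
  · have : x = Fin.last m := by ext; simp; omega
    subst this
    simp

theorem finRotate_iterate_val (x : Fin n) (k : ℕ) :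
    (((finRotate n)^[k] x : Fin n) : ℕ) = (x + k) % n := by
  induction k with
  | zero => simp [Nat.mod_eq_of_lt x.2]
  | succ k ih =>
    rw [Function.iterate_succ_apply', finRotate_val, ih]
    have hn : 0 < n := by have := x.2; omega
    have h1 := Nat.mod_lt (x + k) hn
    have h2 : (x + (k + 1)) % n = ((x + k) % n + 1) % n := by
      rw [← Nat.add_assoc, Nat.mod_add_mod]
    rw [h2]
    split_ifs with h
    · rw [Nat.mod_eq_of_lt h]
    · have : (x + k) % n + 1 = n := by omega
      rw [this, Nat.mod_self]

theorem exists_finRotate_iterate_eq (x y : Fin n) : ∃ k, (finRotate n)^[k] x = y := by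
  refine ⟨n - x + y, ?_⟩
  ext
  have := x.2
  rw [finRotate_iterate_val, show (x : ℕ) + (n - x + y) = n + y by omega, Nat.add_mod_left,
    Nat.mod_eq_of_lt y.2]

/-- Every position `x` belongs to the segment that ends at the position `p (seg x)`. -/
theorem exists_segment (p : Fin 5 → Fin n) (hp : StrictMono p) :
    ∃ seg : Fin n → Fin 5, (∀ i, seg (p i) = i) ∧ (∀ i, seg (finRotate n (p i)) = i + 1) ∧
      ∀ x, (∀ i, p i ≠ x) → seg (finRotate n x) = seg x := by
  let cnt : ℕ → ℕ := fun x => (Finset.univ.filter fun j => (p j : ℕ) < x).card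
  have h0 : cnt 0 = 0 := by simp [cnt]
  -- The segment is the number of removed positions before `x`, modulo 5: what follows the last
  -- removed edge continues into the segment that ends at `p 0`, as the tour closes up.
  refine ⟨fun x => Fin.ofNat 5 (cnt x), ?_, ?_, ?_⟩
  · intro i
    have : cnt (p i) = i := by
      have : (Finset.univ.filter fun j => (p j : ℕ) < p i) = Finset.Iio i := by
        ext j
        simpa using hp.lt_iff_lt (a := j) (b := i)
      simp only [cnt]
      rw [this, Fin.card_Iio]
    simp only [this]
    ext; simp
  · intro i
    simp only [finRotate_val]
    split_ifs with h
    · have : cnt (p i + 1) = i + 1 := by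
        have : (Finset.univ.filter fun j => (p j : ℕ) < p i + 1) = Finset.Iic i := by
          ext j
          have := hp.le_iff_le (a := j) (b := i)
          simp [← this]
        simp only [cnt]
        rw [this, Fin.card_Iic]
      rw [this]
      ext; simp [Fin.val_add]
    · have : i = 4 := by
        by_contra hi
        have := hp (a := i) (b := 4) (by omega)
        have := (p 4).2
        omega
      rw [h0, this]
      rfl
  · intro x hx
    simp only [finRotate_val]
    split_ifs with h
    · congr 1
      simp only [cnt]
      congr 1
      ext j
      have := hx j
      have : (p j : ℕ) ≠ x := fun h => this (Fin.ext h)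
      simp only [Finset.mem_filter, Finset.mem_univ, true_and]
      omega
    · rw [h0]
      have : cnt x = 5 := by
        have : (Finset.univ.filter fun j => (p j : ℕ) < x) = Finset.univ := by
          ext j
          have := hx j
          have : (p j : ℕ) ≠ x := fun h => this (Fin.ext h)
          have := (p j).2
          simp only [Finset.mem_filter, Finset.mem_univ, true_and, iff_true]
          omega
        simp only [cnt]
        rw [this]; simp
      rw [this]
      rfl

/-- A property that is constant along the segments has the same value at `x` and at the end of
the segment of `x`. -/
theorem segment_const (p : Fin 5 → Fin n) (seg : Fin n → Fin 5) (h1 : ∀ i, seg (p i) = i)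
    (h2 : ∀ x, (∀ i, p i ≠ x) → seg (finRotate n x) = seg x) (C : Fin n → Prop)
    (hC : ∀ x, (∀ i, p i ≠ x) → (C x ↔ C (finRotate n x))) (x : Fin n) :
    C x ↔ C (p (seg x)) := by
  -- Walk forward from `x`: `p 0` is eventually reached, so the induction ends there or earlier, at
  -- the first removed position met.
  obtain ⟨k, hk⟩ := exists_finRotate_iterate_eq x (p 0)
  induction k generalizing x with
  | zero =>
    simp only [Function.iterate_zero, id] at hk
    rw [hk, h1]
  | succ k ih =>
    by_cases hx : ∃ i, p i = x
    · obtain ⟨i, rfl⟩ := hx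
      rw [h1]
    · push Not at hx
      rw [hC x hx, ih _ hk, h2 x hx]

/-! ### The correspondence between 5-moves and valid patterns -/

namespace Instance
variable (I : Instance n)

/-- The ends of the tour edges: `(x, b)` is the first or second end of the `x`-th edge. -/
def dart (d : Fin n × Bool) : Fin n := I.tour (if d.2 then finRotate n d.1 else d.1)

/-- The vertex at an end of a removed edge, when the edges with numbers `p i` are removed. -/
def slotVertex (p : Fin 5 → Fin n) (s : Slot) : Fin n := I.dart (p s.1, s.2)

/-- The tour edge number `x`. -/
def tourEdge (x : Fin n) : Sym2 (Fin n) := s(I.dart (x, false), I.dart (x, true))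

/-- The removed edges. -/
def removed (p : Fin 5 → Fin n) : Finset (Sym2 (Fin n)) :=
  Finset.univ.image fun i => I.tourEdge (p i)

/-- The added edges. -/
def added (p : Fin 5 → Fin n) (φ : Equiv.Perm Slot) : Finset (Sym2 (Fin n)) :=
  Finset.univ.image fun k => s(I.slotVertex p (φ (k, false)), I.slotVertex p (φ (k, true)))

theorem tourEdges_eq : I.tourEdges = Finset.univ.image I.tourEdge := rfl

theorem tourEdge_injective (hn : 3 ≤ n) : Function.Injective I.tourEdge := by
  intro x y hxy
  simp only [tourEdge, dart, Sym2.eq_iff, EmbeddingLike.apply_eq_iff_eq, Bool.false_eq_true,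
    if_false, if_true] at hxy
  rcases hxy with h | ⟨h1, h2⟩
  · exact h.1
  · exfalso
    have h3 := finRotate_val x
    have h4 := finRotate_val y
    rw [h2] at h3
    rw [← h1] at h4
    have := x.2
    have := y.2
    split_ifs at h3 h4 <;> omega

theorem card_tourEdges (hn : 3 ≤ n) : I.tourEdges.card = n := by
  rw [tourEdges_eq, Finset.card_image_of_injective _ (I.tourEdge_injective hn)]; simp

theorem dart_ne (hn : 3 ≤ n) (x : Fin n) : I.dart (x, false) ≠ I.dart (x, true) := by
  intro h
  simp only [dart, EmbeddingLike.apply_eq_iff_eq, Bool.false_eq_true, if_false, if_true] at h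
  have h3 := finRotate_val x
  rw [← h] at h3
  have := x.2
  split_ifs at h3 <;> omega

theorem card_dart_fiber (v : Fin n) :
    (Finset.univ.filter fun d => I.dart d = v).card = 2 := by
  rw [Finset.card_eq_two]
  refine ⟨(I.tour.symm v, false), ((finRotate n).symm (I.tour.symm v), true), by simp, ?_⟩
  ext ⟨x, b⟩
  cases b <;> simp [dart, ← Equiv.eq_symm_apply, -finRotate_apply]

theorem card_removed (hn : 3 ≤ n) {p : Fin 5 → Fin n} (hp : Function.Injective p) :
    (I.removed p).card = 5 := by
  have h : Function.Injective fun i => I.tourEdge (p i) := (I.tourEdge_injective hn).comp hp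
  rw [removed, Finset.card_image_of_injective _ h]; simp

theorem removed_subset (p : Fin 5 → Fin n) : I.removed p ⊆ I.tourEdges := by
  rw [tourEdges_eq, removed]
  intro e
  simp only [Finset.mem_image, Finset.mem_univ, true_and]
  rintro ⟨i, rfl⟩
  exact ⟨_, rfl⟩

theorem mem_tourEdges_sdiff_removed (hn : 3 ≤ n) (p : Fin 5 → Fin n) (e : Sym2 (Fin n)) :
    e ∈ I.tourEdges \ I.removed p ↔ ∃ x, (∀ i, p i ≠ x) ∧ I.tourEdge x = e := by
  simp only [tourEdges_eq, removed, Finset.mem_sdiff, Finset.mem_image, Finset.mem_univ, true_and]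
  constructor
  · rintro ⟨⟨x, rfl⟩, h⟩
    exact ⟨x, fun i hi => h ⟨i, by rw [hi]⟩, rfl⟩
  · rintro ⟨x, hx, rfl⟩
    exact ⟨⟨x, rfl⟩, fun ⟨i, hi⟩ => hx i (I.tourEdge_injective hn hi)⟩

/-- Permuting the ends of tour edges keeps two darts at each vertex. A predicate constant along the
new edges is constant on each segment, so it is determined by its values at the slots, where
validity of `φ` applies. -/
theorem isMove_of_validPattern (hn : 3 ≤ n) {p : Fin 5 → Fin n} (hp : StrictMono p)
    {φ : Equiv.Perm Slot} (hφ : ValidPattern φ) :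
    I.IsMove 5 (I.removed p) (I.added p φ) := by
  classical
  let ι : Slot ↪ Fin n × Bool := ⟨fun s => (p s.1, s.2), fun s t h => by
    have h := Prod.mk.inj h
    exact Prod.ext (hp.injective h.1) h.2⟩
  -- `φ` on the ends of removed edges, the identity on all other darts.
  let Φ := φ.viaEmbedding ι
  let D : Fin n × Bool → Fin n := fun d => I.dart (Φ d)
  have hD1 : ∀ i b, D (p i, b) = I.slotVertex p (φ (i, b)) := by
    intro i b
    have : Φ (ι (i, b)) = ι (φ (i, b)) := Equiv.Perm.viaEmbedding_apply ..
    exact congrArg I.dart this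
  have hD2 : ∀ x b, (∀ i, p i ≠ x) → D (x, b) = I.dart (x, b) := by
    intro x b hx
    have : Φ (x, b) = (x, b) := by
      refine Equiv.Perm.viaEmbedding_apply_of_notMem _ _ _ ?_
      rintro ⟨s, hs⟩
      exact hx s.1 (Prod.mk.inj hs).1
    exact congrArg I.dart this
  have hF : (I.tourEdges \ I.removed p) ∪ I.added p φ =
      Finset.univ.image fun x => s(D (x, false), D (x, true)) := by
    ext e
    rw [Finset.mem_union, I.mem_tourEdges_sdiff_removed hn]
    simp only [added, Finset.mem_image, Finset.mem_univ, true_and]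
    constructor
    · rintro (⟨x, hx, rfl⟩ | ⟨k, rfl⟩)
      · exact ⟨x, by rw [hD2 x _ hx, hD2 x _ hx]; rfl⟩
      · exact ⟨p k, by rw [hD1, hD1]⟩
    · rintro ⟨x, rfl⟩
      by_cases hx : ∃ i, p i = x
      · obtain ⟨i, rfl⟩ := hx
        exact Or.inr ⟨i, by rw [hD1, hD1]⟩
      · push Not at hx
        exact Or.inl ⟨x, hx, by rw [hD2 x _ hx, hD2 x _ hx]; rfl⟩
  obtain ⟨seg, hs1, hs2, hs3⟩ := exists_segment p hp
  have hham : IsHamiltonianCycleEdgeSet ((I.tourEdges \ I.removed p) ∪ I.added p φ) := by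
    rw [hF]
    refine isHamiltonianCycleEdgeSet_of_darts hn D ?_ ?_
    · intro v
      rw [← I.card_dart_fiber v]
      refine Finset.card_bij (fun d _ => Φ d) ?_ ?_ ?_
      · intro d hd; simpa using hd
      · intro d _ d' _ h; exact Φ.injective h
      · intro d hd
        exact ⟨Φ.symm d, by simpa [D] using hd, by simp⟩
    · intro C hC
      have hstep : ∀ x, (∀ i, p i ≠ x) →
          (C (I.tour x) ↔ C (I.tour (finRotate n x))) := by
        intro x hx
        have := hC x
        rw [hD2 x _ hx, hD2 x _ hx] at this
        simpa [dart] using this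
      have hseg := segment_const p seg hs1 hs3 (fun x => C (I.tour x)) hstep
      have hall := hφ (fun s => C (I.slotVertex p s)) ?_ ?_
      · intro a b ha
        have h1 := hseg (I.tour.symm a)
        have h2 := hseg (I.tour.symm b)
        simp only [Equiv.apply_symm_apply] at h1 h2
        have := hall (seg (I.tour.symm a), false) (seg (I.tour.symm b), false)
        simp only [slotVertex, dart, Bool.false_eq_true, if_false] at this
        exact h2.2 (this (h1.1 ha))
      · intro k
        have := hC (p k)
        rwa [hD1, hD1] at this
      · intro i
        have := hseg (finRotate n (p i))
        rw [hs2] at this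
        simpa [slotVertex, dart] using this
  have hR := I.card_removed hn hp.injective
  have hRT := I.removed_subset p
  refine ⟨hR, ?_, hRT, ?_, hham⟩
  -- The result has `n` edges and `n - 5` of them are kept, so the added edges cannot be fewer than
  -- five.
  · have h1 : (I.added p φ).card ≤ 5 := Finset.card_image_le.trans (by simp)
    have h2 := Finset.card_union_le (I.tourEdges \ I.removed p) (I.added p φ)
    have h3 := Finset.card_sdiff_add_card_eq_card hRT
    rw [hham.card_eq] at h2
    rw [I.card_tourEdges hn] at h3
    omega
  · intro e he
    have := hham.not_isDiag e (Finset.mem_union_right _ he)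
    simpa using this

/-- Tour and result both have degree two everywhere, so every vertex has the same degree in the
removed as in the added edges. Matching the ends vertex by vertex gives `φ`. -/
theorem exists_pattern_of_isMove (hn : 3 ≤ n) {R A : Finset (Sym2 (Fin n))}
    (h : I.IsMove 5 R A) :
    ∃ (p : Fin 5 → Fin n) (φ : Equiv.Perm Slot), StrictMono p ∧ ValidPattern φ ∧
      R = I.removed p ∧ A = I.added p φ := by
  classical
  have hinj := I.tourEdge_injective hn
  obtain ⟨p, hp, hR⟩ : ∃ p, StrictMono p ∧ R = I.removed p := by
    let P : Finset (Fin n) := Finset.univ.filter fun x => I.tourEdge x ∈ R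
    have hPR : P.image I.tourEdge = R := by
      ext e
      simp only [P, Finset.mem_image, Finset.mem_filter, Finset.mem_univ, true_and]
      constructor
      · rintro ⟨x, hx, rfl⟩; exact hx
      · intro he
        have := h.removed_subset he
        rw [tourEdges_eq, Finset.mem_image] at this
        obtain ⟨x, -, rfl⟩ := this
        exact ⟨x, he, rfl⟩
    have hP : P.card = 5 := by
      rw [← Finset.card_image_of_injective P hinj, hPR, h.card_removed]
    refine ⟨P.orderEmbOfFin hP, (P.orderEmbOfFin hP).strictMono, ?_⟩
    rw [← hPR]
    have : P = Finset.univ.image (P.orderEmbOfFin hP) := by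
      ext x
      simp
    conv_lhs => rw [this, Finset.image_image]
    rfl
  subst hR
  have hham := h.hamiltonian
  have hT := I.card_tourEdges hn
  have hsub := I.removed_subset p
  -- Both sides together have `(n - 5) + 5` edges, and their union has `n`.
  have hdisj : Disjoint (I.tourEdges \ I.removed p) A := by
    rw [← Finset.card_union_eq_card_add_card, hham.card_eq, h.card_added]
    have := Finset.card_sdiff_add_card_eq_card hsub
    rw [h.card_removed, hT] at this
    exact this.symm
  let f : Fin 5 ≃ A := (Fintype.equivFinOfCardEq (by simp [h.card_added])).symm
  have hf : ∀ k, ∃ a b, (f k : Sym2 (Fin n)) = s(a, b) := by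
    intro k
    rcases (f k : Sym2 (Fin n)) with ⟨a, b⟩
    exact ⟨a, b, rfl⟩
  choose a b hab using hf
  have hne : ∀ k, a k ≠ b k := by
    intro k hk
    have := hham.not_isDiag _ (Finset.mem_union_right _ (f k).2)
    rw [hab, Sym2.mk_isDiag_iff] at this
    exact this hk
  -- Without loops, the ends located at `v` correspond to the edges incident with `v`.
  have count : ∀ (E : Fin 5 → Sym2 (Fin n)) (D : Slot → Fin n), Function.Injective E →
      (∀ k, E k = s(D (k, false), D (k, true))) → (∀ k, D (k, false) ≠ D (k, true)) →
      ∀ v, (Finset.univ.filter fun d => D d = v).card =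
        ((Finset.univ.image E).filter fun e => v ∈ e).card := by
    intro E D hE hED hD v
    refine Finset.card_bij (fun d _ => E d.1) ?_ ?_ ?_
    · rintro ⟨k, c⟩ hd
      simp only [Finset.mem_filter, Finset.mem_univ, true_and] at hd
      simp only [Finset.mem_filter, Finset.mem_image, Finset.mem_univ, true_and,
        exists_apply_eq_apply, hED, ← hd]
      cases c <;> simp
    · rintro ⟨k, c⟩ hd ⟨k', c'⟩ hd' hkk
      simp only [Finset.mem_filter, Finset.mem_univ, true_and] at hd hd'
      obtain rfl : k = k' := hE hkk
      have := hD k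
      cases c <;> cases c' <;> simp_all
    · intro e he
      simp only [Finset.mem_filter, Finset.mem_image, Finset.mem_univ, true_and] at he
      obtain ⟨⟨k, rfl⟩, hv⟩ := he
      rw [hED, Sym2.mem_iff] at hv
      rcases hv with hv | hv
      · exact ⟨(k, false), by simp [hv], rfl⟩
      · exact ⟨(k, true), by simp [hv], rfl⟩
  let D : Slot → Fin n := fun s => if s.2 then b s.1 else a s.1
  have hAimage : Finset.univ.image (fun k => (f k : Sym2 (Fin n))) = A := by
    ext e
    simp only [Finset.mem_image, Finset.mem_univ, true_and]
    constructor
    · rintro ⟨k, rfl⟩; exact (f k).2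
    · intro he
      exact ⟨f.symm ⟨e, he⟩, by simp⟩
  have hA := count (fun k => f k) D (fun k l hkl => f.injective (Subtype.ext hkl))
    (fun k => by simp [D, hab]) (fun k => by simpa [D] using hne k)
  have hS := count (fun k => I.tourEdge (p k)) (I.slotVertex p) (hinj.comp hp.injective)
    (fun k => rfl) (fun k => I.dart_ne hn _)
  have hdegT : ∀ v, (I.tourEdges.filter fun e => v ∈ e).card = 2 := by
    have hham0 : IsHamiltonianCycleEdgeSet I.tourEdges := by
      rw [tourEdges_eq]
      refine isHamiltonianCycleEdgeSet_of_darts hn I.dart I.card_dart_fiber ?_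
      intro C hC x y hx
      obtain ⟨k, hk⟩ := exists_finRotate_iterate_eq (I.tour.symm x) (I.tour.symm y)
      have key : ∀ k, C (I.tour ((finRotate n)^[k] (I.tour.symm x))) := by
        intro k
        induction k with
        | zero => simpa using hx
        | succ k ih =>
          rw [Function.iterate_succ_apply']
          have := hC ((finRotate n)^[k] (I.tour.symm x))
          simp only [dart, Bool.false_eq_true, if_false, if_true] at this
          exact this.1 ih
      have := key k
      rwa [hk, Equiv.apply_symm_apply] at this
    exact hham0.card_incident
  obtain ⟨φ, hφ⟩ := exists_equiv_of_card_fiber_eq D (I.slotVertex p) (by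
    intro v
    rw [hA, hS, hAimage]
    have h1 := hham.card_incident v
    rw [Finset.filter_union, Finset.card_union_of_disjoint
      (Finset.disjoint_filter_filter hdisj)] at h1
    have h2 := hdegT v
    rw [← Finset.sdiff_union_of_subset hsub, Finset.filter_union, Finset.card_union_of_disjoint
      (Finset.disjoint_filter_filter Finset.sdiff_disjoint)] at h2
    have h3 : (Finset.univ.image fun k => I.tourEdge (p k)) = I.removed p := rfl
    rw [h3]
    omega)
  have hadd : A = I.added p φ := by
    rw [← hAimage, added]
    refine Finset.image_congr fun k _ => ?_
    simp only [hφ, hab]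
    simp [D]
  refine ⟨p, φ, hp, ?_, rfl, hadd⟩
  obtain ⟨seg, hs1, hs2, hs3⟩ := exists_segment p hp
  intro C hC1 hC2
  -- `C` on slots is spread to vertices by taking its value at the end of the segment. At a slot
  -- `(i, true)` this is `C (i + 1, false)`, which agrees by `hC2`.
  have hslot : ∀ s : Slot, C (seg (I.tour.symm (I.slotVertex p s)), false) ↔ C s := by
    rintro ⟨i, c⟩
    cases c
    · simp [slotVertex, dart, hs1]
    · simp [slotVertex, dart, hs2, hC2, -finRotate_apply]
  have := hham.connected (fun v => C (seg (I.tour.symm v), false)) ?_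
  · intro s t hs
    rw [← hslot] at hs ⊢
    exact this _ _ hs
  · have hadj : ∀ {x y x' y' : Fin n}, s(x, y) = s(x', y') →
        (C (seg (I.tour.symm x'), false) ↔ C (seg (I.tour.symm y'), false)) →
        (C (seg (I.tour.symm x), false) ↔ C (seg (I.tour.symm y), false)) := by
      intro x y x' y' hxy
      rw [Sym2.eq_iff] at hxy
      rcases hxy with ⟨rfl, rfl⟩ | ⟨rfl, rfl⟩
      · exact id
      · exact Iff.symm
    intro x y hxy
    rw [Finset.mem_union, I.mem_tourEdges_sdiff_removed hn, hadd] at hxy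
    rcases hxy with ⟨z, hz, hxy⟩ | hxy
    · refine hadj hxy.symm ?_
      simp [dart, hs3 z hz, -finRotate_apply]
    · simp only [added, Finset.mem_image, Finset.mem_univ, true_and] at hxy
      obtain ⟨k, hk⟩ := hxy
      refine hadj hk.symm ?_
      rw [hslot, hslot]
      exact hC1 k

end Instance

end

end KOpt

namespace KOpt

/-! ### The gain as a function of the positions of the removed edges -/

/-- The position, along the tour, of an end of a removed edge. -/
def slotPos (p : Fin 5 → ℕ) (s : Slot) : ℕ := p s.1 + s.2.toNat

/-- The gain for removed edges at the positions `p` and the reconnection `φ`; `d x y` is the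
distance between the vertices at the positions `x` and `y`. -/
def patternGain (d : ℕ → ℕ → ℤ) (φ : Equiv.Perm Slot) (p : Fin 5 → ℕ) : ℤ :=
  (∑ i, d (slotPos p (i, false)) (slotPos p (i, true))) -
    ∑ k, d (slotPos p (φ (k, false))) (slotPos p (φ (k, true)))

/-- Moving `u` changes only the length of its own removed edge and of the added edges at it, and
these see no positions but those of `u`, `α`, `β`. So the comparison of two positions of `u` does
not depend on the other indices. -/
theorem patternGain_exchange (d : ℕ → ℕ → ℤ) {φ : Equiv.Perm Slot} {u α β : Fin 5}
    (h : ∀ k b, (φ (k, b)).1 = u → ∀ c, (φ (k, c)).1 = u ∨ (φ (k, c)).1 = α ∨ (φ (k, c)).1 = β)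
    {p p' : Fin 5 → ℕ} (hα : p α = p' α) (hβ : p β = p' β) (x y : ℕ) :
    patternGain d φ (Function.update p u x) - patternGain d φ (Function.update p u y) =
      patternGain d φ (Function.update p' u x) - patternGain d φ (Function.update p' u y) := by
  have same : ∀ (q : Fin 5 → ℕ) (x : ℕ) (s : Slot), s.1 ≠ u →
      slotPos (Function.update q u x) s = slotPos q s := by
    intro q x s hs
    simp [slotPos, Function.update_of_ne hs]
  have agree : ∀ (x : ℕ) (s : Slot), s.1 = u ∨ s.1 = α ∨ s.1 = β →
      slotPos (Function.update p u x) s = slotPos (Function.update p' u x) s := by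
    intro x s hs
    simp only [slotPos, Function.update_apply]
    split_ifs with h
    · rfl
    · rcases hs with hs | hs | hs
      · exact absurd hs h
      · rw [hs, hα]
      · rw [hs, hβ]
  have diff : ∀ f f' g g' : Fin 5 → ℤ, (∀ k, f k - g k = f' k - g' k) →
      (∑ k, f k) - ∑ k, g k = (∑ k, f' k) - ∑ k, g' k := by
    intro f f' g g' h
    rw [← Finset.sum_sub_distrib, ← Finset.sum_sub_distrib]
    exact Finset.sum_congr rfl fun k _ => h k
  unfold patternGain
  rw [sub_sub_sub_comm]
  refine Eq.trans (congrArg₂ (fun a b : ℤ => a - b) (diff _ _ _ _ fun k => ?_)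
    (diff _ _ _ _ fun k => ?_)) (sub_sub_sub_comm _ _ _ _)
  · by_cases hk : k = u
    · rw [agree _ _ (Or.inl hk), agree _ _ (Or.inl hk), agree _ _ (Or.inl hk),
        agree _ _ (Or.inl hk)]
    · rw [same _ _ _ hk, same _ _ _ hk, same _ _ _ hk, same _ _ _ hk, same _ _ _ hk,
        same _ _ _ hk, same _ _ _ hk, same _ _ _ hk]
      simp
  · by_cases hk : ∃ b, (φ (k, b)).1 = u
    · obtain ⟨b, hb⟩ := hk
      have := h k b hb
      rw [agree _ _ (this false), agree _ _ (this true), agree _ _ (this false),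
        agree _ _ (this true)]
    · push Not at hk
      rw [same _ _ _ (hk false), same _ _ _ (hk true), same _ _ _ (hk false), same _ _ _ (hk true),
        same _ _ _ (hk false), same _ _ _ (hk true), same _ _ _ (hk false), same _ _ _ (hk true)]
      simp

/-- The positions `p 0, …, p 4`, preceded by `-1` and followed by `n`. -/
def bound (n : ℕ) (p : Fin 5 → ℕ) : ℕ → ℤ
  | 0 => -1
  | 1 => p 0
  | 2 => p 1
  | 3 => p 2
  | 4 => p 3
  | 5 => p 4
  | _ => n

theorem bound_succ (n : ℕ) (p : Fin 5 → ℕ) (i : Fin 5) : bound n p (i + 1) = p i := by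
  fin_cases i <;> rfl

theorem bound_congr (n : ℕ) {p p' : Fin 5 → ℕ} {j : ℕ} (h : ∀ i : Fin 5, j = i + 1 → p i = p' i) :
    bound n p j = bound n p' j := by
  match j with
  | 0 => rfl
  | 1 => simp [bound, h 0 rfl]
  | 2 => simp [bound, h 1 rfl]
  | 3 => simp [bound, h 2 rfl]
  | 4 => simp [bound, h 3 rfl]
  | 5 => simp [bound, h 4 rfl]
  | _ + 6 => rfl

/-- The positions are increasing and less than `n`. -/
def Increasing (n : ℕ) (p : Fin 5 → ℕ) : Prop := ∀ j < 6, bound n p j < bound n p (j + 1)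

theorem Increasing.bounds {n : ℕ} {p : Fin 5 → ℕ} (h : Increasing n p) :
    p 0 < p 1 ∧ p 1 < p 2 ∧ p 2 < p 3 ∧ p 3 < p 4 ∧ p 4 < n := by
  have h1 := h 1 (by omega)
  have h2 := h 2 (by omega)
  have h3 := h 3 (by omega)
  have h4 := h 4 (by omega)
  have h5 := h 5 (by omega)
  simp only [bound] at h1 h2 h3 h4 h5
  omega

theorem Increasing.lt {n : ℕ} {p : Fin 5 → ℕ} (h : Increasing n p) (i : Fin 5) : p i < n := by
  have := h.bounds
  fin_cases i <;> simp only [Fin.zero_eta, Fin.mk_one, Fin.reduceFinMk] <;> omega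

theorem increasing_iff {n : ℕ} {p : Fin 5 → ℕ} :
    Increasing n p ↔ StrictMono p ∧ ∀ i, p i < n := by
  constructor
  · intro h
    refine ⟨?_, h.lt⟩
    have := h.bounds
    rw [Fin.strictMono_iff_lt_succ]
    intro i
    fin_cases i <;> simp <;> omega
  · rintro ⟨h, hn⟩ j hj
    have h0 := h (a := 0) (b := 1) (by decide)
    have h1 := h (a := 1) (b := 2) (by decide)
    have h2 := h (a := 2) (b := 3) (by decide)
    have h3 := h (a := 3) (b := 4) (by decide)
    have h4 := hn 4
    interval_cases j <;> simp only [bound] <;> omega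

theorem Increasing.update {n : ℕ} {p : Fin 5 → ℕ} (h : Increasing n p) {u : Fin 5} {x : ℕ}
    (h1 : bound n p u < x) (h2 : (x : ℤ) < bound n p (u + 2)) :
    Increasing n (Function.update p u x) := by
  have hp := h.bounds
  intro j hj
  fin_cases u <;> simp only [bound] at h1 h2 <;> interval_cases j <;>
    simp [bound] <;> omega

/-! ### Splitting off two removed edges -/

/-- For the optimization of the `u`-th position: the edges added at the `u`-th removed edge lead
only to the removed edges `u`, `α` and `β`, and one of the positions next to the `u`-th is the
`α`-th or the `β`-th (or missing): the previous one if `up` is true, otherwise the next one. -/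
structure Side (φ : Equiv.Perm Slot) (u v : Fin 5) where
  α : Fin 5
  β : Fin 5
  γ : Fin 5
  up : Bool
  nodup : [u, v, α, β, γ].Nodup
  neighbors : ∀ k b, (φ (k, b)).1 = u →
    ∀ c, (φ (k, c)).1 = u ∨ (φ (k, c)).1 = α ∨ (φ (k, c)).1 = β
  next_up : up = true → (u : ℕ) = 0 ∨ (u : ℕ) = α + 1 ∨ (u : ℕ) = β + 1
  next_down : up = false → (u : ℕ) = 4 ∨ (u : ℕ) + 1 = α ∨ (u : ℕ) + 1 = β

/-- Pigeonhole: six non-consecutive pairs, five added edges. The pair 0, 4 counts as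
non-consecutive, because only the linear order of positions restricts their choice. -/
theorem exists_separated (φ : Equiv.Perm Slot) : ∃ u v : Fin 5, (u : ℕ) + 1 < v ∧
    ∀ k b, (φ (k, b)).1 = u → (φ (k, !b)).1 ≠ v := by
  by_contra hcon
  push Not at hcon
  let T : Finset (Sym2 (Fin 5)) := {s(0, 2), s(0, 3), s(0, 4), s(1, 3), s(1, 4), s(2, 4)}
  have hsub : T ⊆ Finset.univ.image fun k => s((φ (k, false)).1, (φ (k, true)).1) := by
    have key : ∀ u v : Fin 5, (u : ℕ) + 1 < v →
        s(u, v) ∈ Finset.univ.image fun k => s((φ (k, false)).1, (φ (k, true)).1) := by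
      intro u v huv
      obtain ⟨k, b, h1, h2⟩ := hcon u v huv
      refine Finset.mem_image.2 ⟨k, Finset.mem_univ k, ?_⟩
      cases b
      · simp only [Bool.not_false] at h2
        rw [h1, h2]
      · simp only [Bool.not_true] at h2
        rw [h1, h2, Sym2.eq_swap]
    intro e he
    simp only [T, Finset.mem_insert, Finset.mem_singleton] at he
    rcases he with rfl | rfl | rfl | rfl | rfl | rfl <;> exact key _ _ (by decide)
  have h1 := (Finset.card_le_card hsub).trans Finset.card_image_le
  have h2 : T.card = 6 := by decide
  simp [h2] at h1

/-- The two ends of edge `u` have at most two partners, none of them at `v`. Both order neighbours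
of `u`, where they exist, are different from `v`, and at most one of them can be the left-over index
`γ`. -/
theorem exists_side {φ : Equiv.Perm Slot} {u v : Fin 5} (huv : u ≠ v) (h1 : (u : ℕ) + 1 ≠ v)
    (h2 : (v : ℕ) + 1 ≠ u) (h : ∀ k b, (φ (k, b)).1 = u → (φ (k, !b)).1 ≠ v) :
    Nonempty (Side φ u v) := by
  classical
  let other : Slot → Fin 5 := fun s => (φ ((φ.symm s).1, !(φ.symm s).2)).1
  let N : Finset (Fin 5) := {other (u, false), other (u, true)}
  have hN : ∀ k b, (φ (k, b)).1 = u → (φ (k, !b)).1 ∈ N := by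
    intro k b hk
    have : φ (k, b) = (u, (φ (k, b)).2) := Prod.ext hk rfl
    have h3 : (φ (k, !b)).1 = other (u, (φ (k, b)).2) := by
      simp only [other]
      rw [← this]; simp
    rw [h3]
    cases (φ (k, b)).2 <;> simp [N]
  have hNv : v ∉ N := by
    have : ∀ c, other (u, c) ≠ v := by
      intro c
      refine h _ _ ?_
      simp
    simp only [N, Finset.mem_insert, Finset.mem_singleton, not_or]
    exact ⟨(this _).symm, (this _).symm⟩
  have hsub : N.erase u ⊆ {u, v}ᶜ := by
    intro w hw
    simp only [Finset.mem_erase] at hw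
    simp only [Finset.mem_compl, Finset.mem_insert, Finset.mem_singleton, not_or]
    exact ⟨hw.1, fun h => hNv (h ▸ hw.2)⟩
  have hcard : ({u, v}ᶜ : Finset (Fin 5)).card = 3 := by
    rw [Finset.card_compl, Finset.card_pair huv]; rfl
  -- There may be fewer than two partners other than `u`; the set is padded to exactly two indices.
  obtain ⟨P, hP1, hP2, hP3⟩ := Finset.exists_subsuperset_card_eq hsub
    ((Finset.card_le_card (Finset.erase_subset _ _)).trans Finset.card_le_two)
    (by omega : 2 ≤ ({u, v}ᶜ : Finset (Fin 5)).card)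
  obtain ⟨α, β, hαβ, rfl⟩ := Finset.card_eq_two.1 hP3
  obtain ⟨γ, hγ⟩ := Finset.card_eq_one.1 (by
    rw [Finset.card_sdiff_of_subset hP2, hcard, hP3] :
      (({u, v}ᶜ : Finset (Fin 5)) \ {α, β}).card = 1)
  have hmem : γ ∈ ({u, v}ᶜ : Finset (Fin 5)) \ {α, β} := by rw [hγ]; simp
  have hα : α ∈ ({u, v}ᶜ : Finset (Fin 5)) := hP2 (by simp)
  have hβ : β ∈ ({u, v}ᶜ : Finset (Fin 5)) := hP2 (by simp)
  have hall : ∀ w, w ≠ u → w ≠ v → w ≠ α → w ≠ β → w = γ := by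
    intro w hu hv hα hβ
    have : w ∈ ({u, v}ᶜ : Finset (Fin 5)) \ {α, β} := by simp [*]
    rwa [hγ, Finset.mem_singleton] at this
  simp only [Finset.mem_sdiff, Finset.mem_compl, Finset.mem_insert, Finset.mem_singleton,
    not_or] at hmem hα hβ
  have hnodup : [u, v, α, β, γ].Nodup := by
    simp only [List.nodup_cons, List.mem_cons, List.not_mem_nil, or_false, not_or,
      not_false_eq_true, List.nodup_nil, and_true]
    exact ⟨⟨huv, Ne.symm hα.1, Ne.symm hβ.1, Ne.symm hmem.1.1⟩,
      ⟨Ne.symm hα.2, Ne.symm hβ.2, Ne.symm hmem.1.2⟩, ⟨hαβ, Ne.symm hmem.2.1⟩, Ne.symm hmem.2.2⟩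
  have hnb : ∀ k b, (φ (k, b)).1 = u →
      ∀ c, (φ (k, c)).1 = u ∨ (φ (k, c)).1 = α ∨ (φ (k, c)).1 = β := by
    intro k b hk c
    by_cases hc : c = b
    · left; rw [hc, hk]
    · obtain rfl : c = !b := by cases b <;> cases c <;> simp_all
      by_cases hu : (φ (k, !b)).1 = u
      · exact Or.inl hu
      · have := hP1 (Finset.mem_erase.2 ⟨hu, hN k b hk⟩)
        simpa using Or.inr this
  by_cases hup : (u : ℕ) = 0 ∨ (u : ℕ) = α + 1 ∨ (u : ℕ) = β + 1
  · exact ⟨⟨α, β, γ, true, hnodup, hnb, fun _ => hup, by simp⟩⟩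
  · refine ⟨⟨α, β, γ, false, hnodup, hnb, by simp, fun _ => ?_⟩⟩
    push Not at hup
    -- If the upward scan is not available, `u - 1` exists and can only be `γ`; so `u + 1` is not
    -- `γ`.
    have hpred : (⟨u - 1, by omega⟩ : Fin 5) = γ :=
      hall _ (by simp [Fin.ext_iff]; omega) (by simp [Fin.ext_iff]; omega)
        (by simp [Fin.ext_iff]; omega) (by simp [Fin.ext_iff]; omega)
    by_contra hcon
    push Not at hcon
    have hsucc : (⟨u + 1, by omega⟩ : Fin 5) = γ :=
      hall _ (by simp [Fin.ext_iff]) (by simp [Fin.ext_iff]; omega)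
        (by simp [Fin.ext_iff]; omega) (by simp [Fin.ext_iff]; omega)
    rw [← hsucc] at hpred
    simp [Fin.ext_iff] at hpred

/-! ### Optima of initial segments of a one-sided scan -/

namespace Side
variable {φ : Equiv.Perm Slot} {u v : Fin 5} (S : Side φ u v)

/-- The index of the lower bound for the scanned positions. -/
def lo : ℕ := if S.up then u else 0

/-- The index of the upper bound for the scanned positions. -/
def hi : ℕ := if S.up then 6 else u + 2

/-- The `j`-th scanned position. -/
def scanPos (n j : ℕ) : ℤ := if S.up then j else n - 1 - j

/-- The number of positions to scan before the optimum is known. -/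
def readIndex (n : ℕ) (p : Fin 5 → ℕ) : ℤ :=
  if S.up then bound n p (u + 2) else n - 1 - bound n p u

/-- The positions with all entries `0`, except for the `α`-th and `β`-th. -/
def base (a b : ℕ) (j : Fin 5) : ℕ := if j = S.α then a else if j = S.β then b else 0

/-- The position `x` is one of the first `i` scanned, and within the bounds. -/
def Scanned (n a b i x : ℕ) : Prop :=
  ∃ j < i, S.scanPos n j = x ∧ bound n (S.base a b) S.lo < x ∧ (x : ℤ) < bound n (S.base a b) S.hi

/-- `c` is a scanned position that is best for the `u`-th removed edge, or `-1` if there is none. -/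
def IsBest (d : ℕ → ℕ → ℤ) (n a b i : ℕ) (c : ℤ) : Prop :=
  (c = -1 ∧ ∀ x, ¬ S.Scanned n a b i x) ∨
    ∃ x : ℕ, c = x ∧ S.Scanned n a b i x ∧ ∀ y, S.Scanned n a b i y →
      patternGain d φ (Function.update (S.base a b) u y) ≤
        patternGain d φ (Function.update (S.base a b) u x)

theorem ne : u ≠ v ∧ u ≠ S.α ∧ u ≠ S.β ∧ u ≠ S.γ ∧ v ≠ S.α ∧ v ≠ S.β ∧ v ≠ S.γ ∧
    S.α ≠ S.β ∧ S.α ≠ S.γ ∧ S.β ≠ S.γ := by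
  have := S.nodup
  simp only [List.nodup_cons, List.mem_cons, List.not_mem_nil, or_false, not_or,
    not_false_eq_true, List.nodup_nil, and_true] at this
  tauto

theorem lo_cases : S.lo = 0 ∨ S.lo = S.α + 1 ∨ S.lo = S.β + 1 := by
  have := S.next_up
  unfold lo
  cases h : S.up <;> simp_all

theorem hi_cases : S.hi = 6 ∨ S.hi = S.α + 1 ∨ S.hi = S.β + 1 := by
  have := S.next_down
  unfold hi
  cases h : S.up
  · simp only [h, forall_true_left] at this
    simp only [Bool.false_eq_true, if_false]
    omega
  · simp

theorem base_α (a b : ℕ) : S.base a b S.α = a := by simp [base]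

theorem base_β (a b : ℕ) : S.base a b S.β = b := by simp [base, S.ne.2.2.2.2.2.2.2.1.symm]

theorem bound_base {n : ℕ} {p : Fin 5 → ℕ} {j : ℕ} (hj : j = 0 ∨ j = 6 ∨ j = S.α + 1 ∨ j = S.β + 1) :
    bound n (S.base (p S.α) (p S.β)) j = bound n p j := by
  refine bound_congr n fun i hi => ?_
  rcases hj with hj | hj | hj | hj
  · omega
  · omega
  · obtain rfl : i = S.α := Fin.ext (by omega)
    rw [S.base_α]
  · obtain rfl : i = S.β := Fin.ext (by omega)
    rw [S.base_β]

/-- One end of the admissible range is tested explicitly through `lo` and `hi`; the other is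
enforced by stopping the scan at `readIndex`. -/
theorem scanned_readIndex {n : ℕ} {p : Fin 5 → ℕ} (h : Increasing n p) (i x : ℕ)
    (hi : S.readIndex n p = i) :
    S.Scanned n (p S.α) (p S.β) i x ↔ bound n p u < x ∧ (x : ℤ) < bound n p (u + 2) := by
  have hb := h.bounds
  have h1 := S.lo_cases
  have h2 := S.hi_cases
  unfold Scanned
  rw [S.bound_base (p := p) (by tauto), S.bound_base (p := p) (by tauto)]
  have hlo : -1 ≤ bound n p u := by
    clear * -
    fin_cases u <;> simp [bound]
  have hhi : bound n p (u + 2) ≤ n := by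
    clear * - hb
    fin_cases u <;> simp [bound] <;> omega
  unfold readIndex at hi
  unfold scanPos lo Side.hi
  cases hS : S.up
  · simp only [hS, Bool.false_eq_true, if_false] at hi ⊢
    constructor
    · rintro ⟨j, hj, hj2, hj3, hj4⟩
      omega
    · rintro ⟨hx1, hx2⟩
      refine ⟨n - 1 - x, by omega, by omega, by simp [bound]; omega, hx2⟩
  · simp only [hS, if_true] at hi ⊢
    constructor
    · rintro ⟨j, hj, hj2, hj3, hj4⟩
      omega
    · rintro ⟨hx1, hx2⟩
      exact ⟨x, by omega, rfl, hx1, by simp [bound]; omega⟩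

/-- The current position `p u` is among those scanned, so an optimum exists and is at least as good.
It was computed with the positions of `v` and `γ` set to 0; `patternGain_exchange` transfers the
comparison to `p`. -/
theorem IsBest.improve {S : Side φ u v} {d : ℕ → ℕ → ℤ} {n : ℕ} {p : Fin 5 → ℕ} {i : ℕ} {c : ℤ}
    (hp : Increasing n p) (hi : S.readIndex n p = i)
    (h : S.IsBest d n (p S.α) (p S.β) i c) :
    ∃ x : ℕ, c = x ∧ bound n p u < x ∧ (x : ℤ) < bound n p (u + 2) ∧
      patternGain d φ p ≤ patternGain d φ (Function.update p u x) := by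
  have hpu : S.Scanned n (p S.α) (p S.β) i (p u) := by
    rw [S.scanned_readIndex hp i _ hi, ← bound_succ n]
    exact ⟨hp u (by omega), hp (u + 1) (by omega)⟩
  rcases h with ⟨-, h⟩ | ⟨x, hc, hx, hbest⟩
  · exact absurd hpu (h _)
  · obtain ⟨h1, h2⟩ := (S.scanned_readIndex hp i _ hi).1 hx
    refine ⟨x, hc, h1, h2, ?_⟩
    have h3 := hbest _ hpu
    have h4 := patternGain_exchange d S.neighbors (S.base_α (p S.α) (p S.β))
      (S.base_β (p S.α) (p S.β)) x (p u)
    rw [Function.update_eq_self] at h4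
    linarith

end Side

end KOpt

namespace KOpt
open RAM

/-! ### Expressions for distances, gains and table addresses

The positions `p 0, …, p 4` of the removed edges are in the registers `31, …, 35`; the registers `30`,
`36` and `45` hold `-1`, `n` and `n + 2`. -/

/-- The memory holds the vertices of the tour in the cells up to `n`, and a table of distances
behind; all its entries are at most `b`, and words hold the numbers up to `B`. -/
structure Layout (n B b : ℕ) (M : ℕ → ℤ) : Prop where
  pos : 1 ≤ n
  vertex : ∀ x ≤ n, 0 ≤ M x ∧ M x < n
  cell : ∀ a < n + n * n, 0 ≤ M a ∧ M a ≤ b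
  gain_le : 10 * b ≤ B
  address_le : 3 * (n + 2) ^ 3 ≤ B

/-- The distance between the vertices at two positions of the tour. -/
def tourDist (n : ℕ) (M : ℕ → ℤ) (x y : ℕ) : ℤ := M (n + (n * (M x).toNat + (M y).toNat))

/-- The constant registers and the input are in place. -/
structure Ready (n : ℕ) (M : ℕ → ℤ) (s : State) : Prop where
  reg_minus_one : s.reg 30 = -1
  reg_n : s.reg 36 = n
  reg_width : s.reg 45 = n + 2
  input : ∀ a < n + n * n, s.mem a = M a

theorem Ready.setReg {n : ℕ} {M : ℕ → ℤ} {s : State} (h : Ready n M s) {x : ℕ} (z : ℤ)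
    (h1 : x ≠ 30) (h2 : x ≠ 36) (h3 : x ≠ 45) : Ready n M (s.setReg x z) :=
  ⟨by rw [s.setReg_of_ne _ h1.symm, h.1], by rw [s.setReg_of_ne _ h2.symm, h.2],
    by rw [s.setReg_of_ne _ h3.symm, h.3], h.4⟩

theorem Ready.of_eq {n : ℕ} {M : ℕ → ℤ} {s t : State} (h : Ready n M s)
    (h1 : t.reg 30 = s.reg 30) (h2 : t.reg 36 = s.reg 36) (h3 : t.reg 45 = s.reg 45)
    (h4 : ∀ a < n + n * n, t.mem a = s.mem a) : Ready n M t :=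
  ⟨h1.trans h.1, h2.trans h.2, h3.trans h.3, fun a ha => (h4 a ha).trans (h.4 a ha)⟩

theorem Ready.reg_bound {n : ℕ} {M : ℕ → ℤ} {s : State} (h : Ready n M s) {p : Fin 5 → ℕ} {j : ℕ}
    (hj : j ≤ 6) (hp : ∀ i : Fin 5, j = i + 1 → s.reg (31 + i) = p i) :
    s.reg (30 + j) = bound n p j := by
  rcases Nat.eq_zero_or_pos j with rfl | h0
  · exact h.1
  · rcases Nat.lt_or_ge j 6 with h6 | h6
    · have h7 := hp ⟨j - 1, by omega⟩ (by simp only; omega)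
      have h8 := bound_succ n p ⟨j - 1, by omega⟩
      simp only [show j - 1 + 1 = j by omega] at h8
      rw [h8, ← h7]
      congr 1
      show 30 + j = 31 + (j - 1)
      omega
    · obtain rfl : j = 6 := by omega
      exact h.2

/-- The vertex at a slot. -/
def slotExpr (a : Slot) : Expr :=
  .load (if a.2 then .add (.var (31 + a.1)) (.const 1) else .var (31 + a.1))

/-- The distance between two slots. -/
def distExpr (a b : Slot) : Expr :=
  .load (.add (.var 36) (.add (.mul (.var 36) (slotExpr a)) (slotExpr b)))

/-- A sum of five terms. -/
def sumExpr (f : Fin 5 → Expr) : Expr :=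
  .add (.add (.add (.add (f 0) (f 1)) (f 2)) (f 3)) (f 4)

/-- The gain of a reconnection. -/
def gainExpr (φ : Equiv.Perm Slot) : Expr :=
  .sub (sumExpr fun i => distExpr (i, false) (i, true))
    (sumExpr fun k => distExpr (φ (k, false)) (φ (k, true)))

/-- The address of an entry of the table number `τ`. -/
def address (n τ a b i : ℕ) : ℕ := ((τ * (n + 2) + a) * (n + 2) + b) * (n + 2) + i

/-- The address of an entry of the table number `τ`, the first two indices being positions. -/
def addressExpr (τ : ℕ) (α β : Fin 5) (e : Expr) : Expr :=
  .add (.mul (.add (.mul (.add (.mul (.const τ) (.var 45)) (.var (31 + α))) (.var 45))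
    (.var (31 + β))) (.var 45)) e

/-! ### Correctness and word bounds of the expressions -/

section
variable {n B b : ℕ} {M : ℕ → ℤ} {s : State}

/-- The input fits into the block of memory that a table number 0 would occupy, so the tables 1 and
2 do not overwrite it. -/
theorem Layout.le_cube (h : Layout n B b M) : n + n * n < (n + 2) ^ 3 ∧ (n + 2) ≤ B ∧
    n + n * n ≤ B ∧ 10 ≤ B := by
  have h1 := h.pos
  have h2 := h.address_le
  have h3 : (n + 2) ^ 3 = n * n * n + 6 * (n * n) + 12 * n + 8 := by ring
  have h4 : 0 ≤ n * n * n := Nat.zero_le _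
  refine ⟨?_, ?_, ?_, ?_⟩ <;> omega

theorem slotPos_le {p : Fin 5 → ℕ} {a : Slot} (h : p a.1 < n) : slotPos p a ≤ n := by
  unfold slotPos
  have := Bool.toNat_le a.2
  omega

theorem slotExpr_spec (hL : Layout n B b M) (hs : Ready n M s) {p : Fin 5 → ℕ} {a : Slot}
    (hp : s.reg (31 + a.1) = p a.1) (hn : p a.1 < n) :
    (slotExpr a).Fits B s ∧ (slotExpr a).val s = M (slotPos p a) := by
  have h1 := hL.le_cube
  have h0 := hL.pos
  have hle : slotPos p a < n + n * n := by
    have := slotPos_le hn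
    have : 0 < n * n := Nat.mul_pos h0 h0
    omega
  obtain ⟨i, c⟩ := a
  simp only at hp hn
  cases c
  · simp only [slotExpr, Bool.false_eq_true, if_false, Expr.Fits, Expr.val, hp, true_and]
    refine ⟨by omega, ?_⟩
    rw [← hs.input _ hle]
    simp [slotPos]
  · simp only [slotExpr, if_true, Expr.Fits, Expr.val, hp, true_and]
    refine ⟨⟨⟨?_, ?_⟩, ?_⟩, ?_⟩
    · rw [abs_of_nonneg (by omega)]; omega
    · rw [abs_of_nonneg (by omega)]; omega
    · omega
    · rw [← hs.input _ hle]
      simp only [slotPos, Bool.toNat_true]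
      congr 1

theorem distExpr_spec (hL : Layout n B b M) (hs : Ready n M s) {p : Fin 5 → ℕ}
    (hp : ∀ i : Fin 5, s.reg (31 + i) = p i) (hn : ∀ i, p i < n) (a c : Slot) :
    (distExpr a c).Fits B s ∧ (distExpr a c).val s = tourDist n M (slotPos p a) (slotPos p c) ∧
      0 ≤ (distExpr a c).val s ∧ (distExpr a c).val s ≤ b := by
  obtain ⟨ha1, ha2⟩ := slotExpr_spec hL hs (hp a.1) (hn a.1)
  obtain ⟨hc1, hc2⟩ := slotExpr_spec hL hs (hp c.1) (hn c.1)
  have hva := hL.vertex _ (slotPos_le (hn a.1))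
  have hvc := hL.vertex _ (slotPos_le (hn c.1))
  have hB := hL.le_cube
  obtain ⟨x, hx⟩ := Int.eq_ofNat_of_zero_le hva.1
  obtain ⟨y, hy⟩ := Int.eq_ofNat_of_zero_le hvc.1
  have hxn : x < n := by omega
  have hyn : y < n := by omega
  have hlt : n + (n * x + y) < n + n * n := by
    have : n * (x + 1) ≤ n * n := Nat.mul_le_mul_left _ hxn
    rw [Nat.mul_add] at this
    omega
  have hcast : ((n : ℤ) + (n * x + y)) = ((n + (n * x + y) : ℕ) : ℤ) := by push_cast; ring
  have hcast2 : ((n : ℤ) * x) = ((n * x : ℕ) : ℤ) := by push_cast; ring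
  have hval : (distExpr a c).val s = M (n + (n * x + y)) := by
    simp only [distExpr, Expr.val, ha2, hc2, hx, hy, hs.reg_n]
    rw [hcast, Int.toNat_natCast, hs.input _ hlt]
  have hcell := hL.cell _ hlt
  refine ⟨?_, ?_, by rw [hval]; exact hcell.1, by rw [hval]; exact hcell.2⟩
  · simp only [distExpr, Expr.Fits, Expr.val, ha2, hc2, hx, hy, hs.reg_n, true_and]
    rw [hcast, hcast2]
    refine ⟨⟨⟨⟨ha1, ?_⟩, hc1, ?_⟩, ?_⟩, by omega⟩
    all_goals
      rw [abs_of_nonneg (by omega)]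
      omega
  · rw [hval, tourDist, hx, hy, Int.toNat_natCast, Int.toNat_natCast]

theorem sumExpr_spec {f : Fin 5 → Expr} {g : Fin 5 → ℤ} (hb : 10 * b ≤ B)
    (h : ∀ i, (f i).Fits B s ∧ (f i).val s = g i ∧ 0 ≤ (f i).val s ∧ (f i).val s ≤ b) :
    (sumExpr f).Fits B s ∧ (sumExpr f).val s = ∑ i, g i ∧ 0 ≤ (sumExpr f).val s ∧
      (sumExpr f).val s ≤ 5 * b := by
  obtain ⟨a0, b0, c0, d0⟩ := h 0
  obtain ⟨a1, b1, c1, d1⟩ := h 1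
  obtain ⟨a2, b2, c2, d2⟩ := h 2
  obtain ⟨a3, b3, c3, d3⟩ := h 3
  obtain ⟨a4, b4, c4, d4⟩ := h 4
  rw [Fin.sum_univ_five, ← b0, ← b1, ← b2, ← b3, ← b4]
  simp only [sumExpr, Expr.Fits, Expr.val]
  refine ⟨⟨⟨⟨⟨a0, a1, ?_⟩, a2, ?_⟩, a3, ?_⟩, a4, ?_⟩, trivial, ?_, ?_⟩
  all_goals first
    | omega
    | (rw [abs_of_nonneg (by omega)]; omega)

theorem gainExpr_spec (hL : Layout n B b M) (hs : Ready n M s) {p : Fin 5 → ℕ}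
    (hp : ∀ i : Fin 5, s.reg (31 + i) = p i) (hn : ∀ i, p i < n) (φ : Equiv.Perm Slot) :
    (gainExpr φ).Fits B s ∧ (gainExpr φ).val s = patternGain (tourDist n M) φ p := by
  obtain ⟨a1, b1, c1, d1⟩ := sumExpr_spec (s := s) hL.gain_le
    fun i : Fin 5 => distExpr_spec hL hs hp hn (i, false) (i, true)
  obtain ⟨a2, b2, c2, d2⟩ := sumExpr_spec (s := s) hL.gain_le
    fun k : Fin 5 => distExpr_spec hL hs hp hn (φ (k, false)) (φ (k, true))
  have := hL.gain_le
  refine ⟨⟨a1, a2, ?_⟩, ?_⟩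
  · rw [abs_le]
    constructor <;> omega
  · simp only [gainExpr, Expr.val, b1, b2, patternGain]

/-- Addresses are numerals in base `n + 2` with leading part `τ`; each table owns a block of `(n +
2) ^ 3` cells. -/
theorem address_lt {τ a c i : ℕ} (ha : a < n + 2) (hc : c < n + 2) (hi : i < n + 2) :
    τ * (n + 2) ^ 3 ≤ address n τ a c i ∧ address n τ a c i < (τ + 1) * (n + 2) ^ 3 := by
  have key : ∀ x y m : ℕ, y < m → x * m ≤ x * m + y ∧ x * m + y + 1 ≤ (x + 1) * m := by
    intro x y m h
    rw [Nat.add_mul]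
    omega
  unfold address
  set m := n + 2
  have h1 := key τ a m ha
  have h2 := key (τ * m + a) c m hc
  have h3 := key ((τ * m + a) * m + c) i m hi
  have h4 := Nat.mul_le_mul_right m h1.1
  have h5 := Nat.mul_le_mul_right m h1.2
  have h6 := Nat.mul_le_mul_right m (h4.trans h2.1)
  have h7 := Nat.mul_le_mul_right m (h2.2.trans h5)
  have e1 : τ * m ^ 3 = τ * m * m * m := by ring
  have e2 : (τ + 1) * m ^ 3 = (τ + 1) * m * m * m := by ring
  rw [e1, e2]
  omega

theorem address_inj {τ a c i a' c' i' : ℕ} (hc : c < n + 2) (hi : i < n + 2) (hc' : c' < n + 2)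
    (hi' : i' < n + 2) (h : address n τ a c i = address n τ a' c' i') :
    a = a' ∧ c = c' ∧ i = i' := by
  have key : ∀ x y x' y' m : ℕ, y < m → y' < m → x * m + y = x' * m + y' → x = x' ∧ y = y' := by
    intro x y x' y' m hy hy' h
    have hm : 0 < m := by omega
    have h1 : (x * m + y) / m = x := by
      rw [Nat.mul_comm, Nat.mul_add_div hm, Nat.div_eq_of_lt hy, Nat.add_zero]
    have h2 : (x' * m + y') / m = x' := by
      rw [Nat.mul_comm, Nat.mul_add_div hm, Nat.div_eq_of_lt hy', Nat.add_zero]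
    have h3 : x = x' := by rw [← h1, h, h2]
    subst h3
    exact ⟨rfl, by omega⟩
  obtain ⟨h1, h2⟩ := key _ _ _ _ _ hi hi' h
  obtain ⟨h3, h4⟩ := key _ _ _ _ _ hc hc' h1
  exact ⟨by omega, h4, h2⟩

theorem addressExpr_spec (hL : Layout n B b M) (hs : Ready n M s) {τ : ℕ} (hτ : τ ≤ 2)
    {α β : Fin 5} {a c i : ℕ} {e : Expr} (ha : s.reg (31 + α) = a) (hc : s.reg (31 + β) = c)
    (ha' : a < n) (hc' : c < n) (he : e.Fits B s) (hi : e.val s = i) (hi' : i < n + 2) :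
    (addressExpr τ α β e).Fits B s ∧ (addressExpr τ α β e).val s = address n τ a c i := by
  have hlt := (address_lt (τ := τ) (by omega : a < n + 2) (by omega : c < n + 2) hi').2
  have hle : (τ + 1) * (n + 2) ^ 3 ≤ 3 * (n + 2) ^ 3 := Nat.mul_le_mul_right _ (by omega)
  have hB := hL.address_le
  have h1 := hL.le_cube
  have e1 : (τ : ℤ) * (n + 2) = ((τ * (n + 2) : ℕ) : ℤ) := by push_cast; ring
  have e2 : (((τ * (n + 2) : ℕ) : ℤ) + a) = ((τ * (n + 2) + a : ℕ) : ℤ) := by push_cast; ring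
  have e3 : ((τ * (n + 2) + a : ℕ) : ℤ) * (n + 2) = (((τ * (n + 2) + a) * (n + 2) : ℕ) : ℤ) := by
    push_cast; ring
  have e4 : (((τ * (n + 2) + a) * (n + 2) : ℕ) : ℤ) + c =
      (((τ * (n + 2) + a) * (n + 2) + c : ℕ) : ℤ) := by push_cast; ring
  have e5 : (((τ * (n + 2) + a) * (n + 2) + c : ℕ) : ℤ) * (n + 2) =
      ((((τ * (n + 2) + a) * (n + 2) + c) * (n + 2) : ℕ) : ℤ) := by push_cast; ring
  have e6 : ((((τ * (n + 2) + a) * (n + 2) + c) * (n + 2) : ℕ) : ℤ) + i = (address n τ a c i : ℕ) := by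
    simp only [address]; push_cast; ring
  have g1 : τ * (n + 2) ≤ τ * (n + 2) + a := Nat.le_add_right _ _
  have g2 : τ * (n + 2) + a ≤ (τ * (n + 2) + a) * (n + 2) := Nat.le_mul_of_pos_right _ (by omega)
  have g3 := Nat.le_add_right ((τ * (n + 2) + a) * (n + 2)) c
  have g4 : (τ * (n + 2) + a) * (n + 2) + c ≤ ((τ * (n + 2) + a) * (n + 2) + c) * (n + 2) :=
    Nat.le_mul_of_pos_right _ (by omega)
  have g5 : ((τ * (n + 2) + a) * (n + 2) + c) * (n + 2) ≤ address n τ a c i := Nat.le_add_right _ _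
  have habs : ∀ m : ℕ, m ≤ address n τ a c i → |(m : ℤ)| ≤ B := by
    intro m hm
    rw [abs_of_nonneg (by omega)]
    omega
  simp only [addressExpr, Expr.Fits, Expr.val, hs.reg_width, ha, hc, hi, e1, e2, e3, e4, e5, e6,
    true_and]
  refine ⟨⟨⟨⟨⟨⟨⟨?_, ?_⟩, ?_⟩, ?_⟩, ?_⟩, ?_⟩, he, ?_⟩, trivial⟩
  · rw [abs_of_nonneg (by omega)]; omega
  all_goals refine habs _ ?_
  all_goals omega

end

end KOpt

namespace KOpt
open RAM

/-! ### The table of best positions for one removed edge -/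

namespace Side
variable {φ : Equiv.Perm Slot} {u v : Fin 5} (S : Side φ u v)

theorem cover (i : Fin 5) : i = u ∨ i = v ∨ i = S.α ∨ i = S.β ∨ i = S.γ := by
  have h := List.toFinset_card_of_nodup S.nodup
  have h2 : [u, v, S.α, S.β, S.γ].toFinset = Finset.univ :=
    Finset.eq_univ_of_card _ (by rw [h]; rfl)
  have h3 : i ∈ [u, v, S.α, S.β, S.γ].toFinset := by rw [h2]; exact Finset.mem_univ i
  simpa using h3

theorem scanned_succ {n a c i x : ℕ} : S.Scanned n a c (i + 1) x ↔ S.Scanned n a c i x ∨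
    (S.scanPos n i = x ∧ bound n (S.base a c) S.lo < x ∧ (x : ℤ) < bound n (S.base a c) S.hi) := by
  constructor
  · rintro ⟨j, hj, h⟩
    rcases Nat.lt_succ_iff_lt_or_eq.1 hj with hj | rfl
    · exact Or.inl ⟨j, hj, h⟩
    · exact Or.inr h
  · rintro (⟨j, hj, h⟩ | h)
    · exact ⟨j, by omega, h⟩
    · exact ⟨i, by omega, h⟩

theorem isBest_zero (d : ℕ → ℕ → ℤ) (n a c : ℕ) : S.IsBest d n a c 0 (-1) :=
  Or.inl ⟨rfl, fun _ ⟨_, hj, _⟩ => absurd hj (Nat.not_lt_zero _)⟩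

/-- The expression for the position to scan in round `i`, the register `43` holding `i`. -/
def scanPosExpr : Expr := if S.up then .var 43 else .sub (.sub (.var 36) (.const 1)) (.var 43)

/-- Makes the scanned position the best one. -/
def updateBest (_ : Side φ u v) : Program := .seq (.assign 42 (.var (31 + u))) (.assign 46 (.var 41))

/-- Compares the scanned position with the best one so far. -/
def compareBest : Program :=
  .seq (.assign 41 (gainExpr φ))
    (.ite (.var 42) (.const 0) S.updateBest (.ite (.var 46) (.var 41) S.updateBest .skip))

/-- One round of the scan: store the best position so far in the register `42`, then compare it
with the next one. The register `46` holds the gain for the best position. -/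
def scanBody (τ : ℕ) : Program :=
  .seq (.store (addressExpr τ S.α S.β (.var 43)) (.var 42))
    (.seq (.assign (31 + u) S.scanPosExpr)
      (.ite (.var (30 + S.lo)) (.var (31 + u))
        (.ite (.var (31 + u)) (.var (30 + S.hi)) S.compareBest .skip) .skip))

theorem scanBody_writes {τ x : ℕ} (h : (S.scanBody τ).Writes x) :
    x = 31 + u ∨ x = 41 ∨ x = 42 ∨ x = 46 := by
  simp only [scanBody, compareBest, updateBest, Program.Writes] at h
  tauto

/-- The state of the registers and the memory after `i` rounds of the scan. -/
structure ScanInv (n : ℕ) (M : ℕ → ℤ) (τ a c : ℕ) (m₀ : ℕ → ℤ) (i : ℕ) (s : State) : Prop where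
  ready : Ready n M s
  regs : ∀ j : Fin 5, j ≠ u → s.reg (31 + j) = S.base a c j
  best : S.IsBest (tourDist n M) n a c i (s.reg 42)
  value : ∀ x : ℕ, s.reg 42 = x →
    s.reg 46 = patternGain (tourDist n M) φ (Function.update (S.base a c) u x)
  table : ∀ j < i, S.IsBest (tourDist n M) n a c j (s.mem (address n τ a c j))
  rest : ∀ x, (∀ j ≤ n, x ≠ address n τ a c j) → s.mem x = m₀ x

variable {n B b : ℕ} {M : ℕ → ℤ}

theorem base_lt {a c : ℕ} (ha : a < n) (hc : c < n) (j : Fin 5) : S.base a c j < n := by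
  unfold base
  split_ifs <;> omega

theorem updateBest_spec {s : State} {Q : State → Prop}
    (h : Q ((s.setReg 42 (s.reg (31 + u))).setReg 46 (s.reg 41))) :
    WP n B S.updateBest s Q := by
  refine WP.seq (WP.assign trivial (WP.assign trivial ?_))
  simpa [Expr.val, State.setReg_of_ne] using h

theorem scanBody_spec (hL : Layout n B b M) {τ a c i : ℕ} {m₀ : ℕ → ℤ} (hτ1 : 1 ≤ τ) (hτ : τ ≤ 2)
    (ha : a < n) (hc : c < n) (hi : i < n + 1) {s : State}
    (hs : S.ScanInv n M τ a c m₀ i s) (h43 : s.reg 43 = i) :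
    WP n B (S.scanBody τ) s fun t => S.ScanInv n M τ a c m₀ (i + 1) (t.setReg 43 (i + 1 : ℕ)) := by
  obtain ⟨-, huα, huβ, -, -, -, -, hαβ, -, -⟩ := S.ne
  have hu := u.2
  have hcube := hL.le_cube
  have hregα : s.reg (31 + S.α) = a := by rw [hs.regs _ huα.symm, S.base_α]
  have hregβ : s.reg (31 + S.β) = c := by rw [hs.regs _ huβ.symm, S.base_β]
  obtain ⟨hf1, hv1⟩ := addressExpr_spec (τ := τ) (e := .var 43) (i := i) hL hs.ready hτ hregα hregβ
    ha hc trivial h43 (by omega)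
  set adr := address n τ a c i with hadr
  have hadr_ge : n + n * n ≤ adr := by
    have := (address_lt (n := n) (τ := τ) (a := a) (c := c) (i := i) (by omega) (by omega)
      (by omega)).1
    have h2 : 1 * (n + 2) ^ 3 ≤ τ * (n + 2) ^ 3 := Nat.mul_le_mul_right _ hτ1
    omega
  set s1 := s.setMem adr (s.reg 42) with hs1
  have hr1 : Ready n M s1 := hs.ready.of_eq rfl rfl rfl fun x hx => s.setMem_of_ne _ (by omega)
  have htable : ∀ j < i + 1, S.IsBest (tourDist n M) n a c j (s1.mem (address n τ a c j)) := by
    intro j hj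
    rcases Nat.lt_succ_iff_lt_or_eq.1 hj with hj | rfl
    · rw [hs1, State.setMem_of_ne]
      · exact hs.table j hj
      · intro h
        have := (address_inj (by omega) (by omega) (by omega) (by omega) h).2.2
        omega
    · rw [hs1, ← hadr, State.setMem_same]
      exact hs.best
  have hrest : ∀ x, (∀ j ≤ n, x ≠ address n τ a c j) → s1.mem x = m₀ x := by
    intro x hx
    rw [hs1, State.setMem_of_ne _ _ (hx i (by omega)), hs.rest x hx]
  -- The common end of all branches of a round: only the facts about the registers 42 and 46 differ.
  have fin : ∀ t : State, t.mem = s1.mem →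
      (∀ x : ℕ, x ≠ 31 + u → x ≠ 41 → x ≠ 42 → x ≠ 46 → t.reg x = s.reg x) →
      S.IsBest (tourDist n M) n a c (i + 1) (t.reg 42) →
      (∀ x : ℕ, t.reg 42 = x →
        t.reg 46 = patternGain (tourDist n M) φ (Function.update (S.base a c) u x)) →
      S.ScanInv n M τ a c m₀ (i + 1) (t.setReg 43 (i + 1 : ℕ)) := by
    intro t h1 h2 h3 h4
    refine ⟨?_, ?_, ?_, ?_, ?_, ?_⟩
    · refine Ready.setReg (hr1.of_eq ?_ ?_ ?_ ?_) _ (by omega) (by omega) (by omega)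
      · exact h2 _ (by omega) (by omega) (by omega) (by omega)
      · exact h2 _ (by omega) (by omega) (by omega) (by omega)
      · exact h2 _ (by omega) (by omega) (by omega) (by omega)
      · intro x _; rw [h1]
    · intro j hj
      have hj' : (j : ℕ) ≠ u := fun h => hj (Fin.ext h)
      have := j.2
      rw [State.setReg_of_ne _ _ (by omega), h2 _ (by omega) (by omega) (by omega) (by omega),
        hs.regs j hj]
    · rwa [State.setReg_of_ne _ _ (by omega)]
    · rwa [State.setReg_of_ne _ _ (by omega), State.setReg_of_ne _ _ (by omega)]
    · rwa [State.setReg_mem, h1]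
    · rwa [State.setReg_mem, h1]
  have hpos : S.scanPosExpr.Fits B s1 ∧ S.scanPosExpr.val s1 = S.scanPos n i := by
    have h36 := hr1.reg_n
    have h43' : s1.reg 43 = i := h43
    unfold scanPosExpr scanPos
    split_ifs
    · exact ⟨trivial, h43'⟩
    · simp only [Expr.Fits, Expr.val, h36, h43', true_and]
      refine ⟨⟨⟨?_, ?_⟩, ?_⟩, trivial⟩
      all_goals
        rw [abs_le]
        constructor <;> omega
  refine WP.seq (WP.store adr hf1 hv1 trivial (WP.seq (WP.assign hpos.1 ?_)))
  change WP n B _ (s1.setReg (31 + u) (S.scanPosExpr.val s1)) _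
  rw [hpos.2]
  set s2 := s1.setReg (31 + u) (S.scanPos n i) with hs2
  have hr2 : Ready n M s2 := hr1.setReg _ (by omega) (by omega) (by omega)
  have hregs2 : ∀ x : ℕ, x ≠ 31 + u → s2.reg x = s.reg x := fun x hx => s1.setReg_of_ne _ hx
  have hbound : ∀ j : ℕ, j ≤ 6 → j ≠ u + 1 → s2.reg (30 + j) = bound n (S.base a c) j := by
    intro j hj hju
    refine hr2.reg_bound hj fun k hk => ?_
    have hku : k ≠ u := fun h => hju (by rw [hk, h])
    rw [hregs2 _ (by omega), hs.regs k hku]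
  have hαu : (S.α : ℕ) ≠ u := fun h => huα (Fin.ext h.symm)
  have hβu : (S.β : ℕ) ≠ u := fun h => huβ (Fin.ext h.symm)
  have hα5 := S.α.2
  have hβ5 := S.β.2
  have hlo : s2.reg (30 + S.lo) = bound n (S.base a c) S.lo := by
    have := S.lo_cases
    exact hbound _ (by omega) (by omega)
  have hhi : s2.reg (30 + S.hi) = bound n (S.base a c) S.hi := by
    have := S.hi_cases
    exact hbound _ (by omega) (by omega)
  have hu2 : s2.reg (31 + u) = S.scanPos n i := by simp [hs2]
  have hskip : (∀ x : ℕ, ¬ (S.scanPos n i = x ∧ bound n (S.base a c) S.lo < x ∧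
      (x : ℤ) < bound n (S.base a c) S.hi)) →
      S.ScanInv n M τ a c m₀ (i + 1) (s2.setReg 43 (i + 1 : ℕ)) := by
    intro hno
    have hscan : ∀ x, S.Scanned n a c (i + 1) x ↔ S.Scanned n a c i x := fun x => by
      rw [S.scanned_succ]; have := hno x; tauto
    refine fin s2 rfl (fun x h1 _ _ _ => hregs2 x h1) ?_ ?_
    · rw [hregs2 _ (by omega)]
      have := hs.best
      simpa only [IsBest, hscan] using this
    · rw [hregs2 _ (by omega), hregs2 _ (by omega)]
      exact hs.value
  refine WP.ite trivial trivial (fun h1 => ?_) (fun h1 => WP.skip (hskip ?_))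
  swap
  · simp only [Expr.val, hlo, hu2] at h1
    rintro x ⟨h2, h3, h4⟩
    omega
  refine WP.ite trivial trivial (fun h2 => ?_) (fun h2 => WP.skip (hskip ?_))
  swap
  · simp only [Expr.val, hhi, hu2] at h2
    rintro x ⟨h3, h4, h5⟩
    omega
  simp only [Expr.val, hlo, hhi, hu2] at h1 h2
  -- The bounds lie between `-1` and `n`, so a scanned value that passes both tests is a position.
  have hxrange : 0 ≤ S.scanPos n i ∧ S.scanPos n i < n := by
    have h3 := hL.pos
    have h4 : -1 ≤ bound n (S.base a c) S.lo := by
      rcases S.lo_cases with h | h | h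
      · rw [h]; exact le_rfl
      · rw [h, bound_succ]; omega
      · rw [h, bound_succ]; omega
    have h5 : bound n (S.base a c) S.hi ≤ n := by
      rcases S.hi_cases with h | h | h
      · rw [h]; exact le_rfl
      · rw [h, bound_succ, S.base_α]; omega
      · rw [h, bound_succ, S.base_β]; omega
    omega
  obtain ⟨x, hx⟩ := Int.eq_ofNat_of_zero_le hxrange.1
  rw [hx] at h1 h2 hu2 hxrange
  have hscan : ∀ y, S.Scanned n a c (i + 1) y ↔ S.Scanned n a c i y ∨ y = x := by
    intro y
    rw [S.scanned_succ, hx]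
    constructor
    · rintro (h | h)
      · exact Or.inl h
      · exact Or.inr (by have := h.1; omega)
    · rintro (h | rfl)
      · exact Or.inl h
      · exact Or.inr ⟨rfl, h1, h2⟩
  have hp2 : ∀ j : Fin 5, s2.reg (31 + j) = Function.update (S.base a c) u x j := by
    intro j
    by_cases hj : j = u
    · subst hj; simp [hu2]
    · have hj' : (j : ℕ) ≠ u := fun h => hj (Fin.ext h)
      rw [hregs2 _ (by omega), Function.update_of_ne hj, hs.regs j hj]
  have hn2 : ∀ j, Function.update (S.base a c) u x j < n := by
    intro j
    by_cases hj : j = u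
    · subst hj; simp; omega
    · rw [Function.update_of_ne hj]; exact S.base_lt ha hc j
  obtain ⟨hgf, hgv⟩ := gainExpr_spec hL hr2 hp2 hn2 φ
  refine WP.seq (WP.assign hgf ?_)
  rw [hgv]
  set g := patternGain (tourDist n M) φ (Function.update (S.base a c) u x) with hg
  set s3 := s2.setReg 41 g with hs3
  have h42 : s3.reg 42 = s.reg 42 := by
    rw [hs3, State.setReg_of_ne _ _ (by omega), hregs2 _ (by omega)]
  have h46 : s3.reg 46 = s.reg 46 := by
    rw [hs3, State.setReg_of_ne _ _ (by omega), hregs2 _ (by omega)]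
  have h41 : s3.reg 41 = g := by simp [hs3]
  have h3u : s3.reg (31 + u) = x := by
    rw [hs3, State.setReg_of_ne _ _ (by omega), hu2]
  have hupd : (∀ y, S.Scanned n a c i y →
      patternGain (tourDist n M) φ (Function.update (S.base a c) u y) ≤ g) →
      WP n B S.updateBest s3 fun t => S.ScanInv n M τ a c m₀ (i + 1) (t.setReg 43 (i + 1 : ℕ)) := by
    intro hle
    refine S.updateBest_spec ?_
    rw [h3u, h41]
    refine fin _ rfl ?_ ?_ ?_
    · intro z hz1 hz2 hz3 hz4
      rw [State.setReg_of_ne _ _ hz4, State.setReg_of_ne _ _ hz3, hs3, State.setReg_of_ne _ _ hz2,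
        hregs2 _ hz1]
    · rw [State.setReg_of_ne _ _ (by omega), State.setReg_same]
      refine Or.inr ⟨x, rfl, (hscan x).2 (Or.inr rfl), fun y hy => ?_⟩
      rcases (hscan y).1 hy with hy | rfl
      · exact hle y hy
      · exact le_rfl
    · intro y hy
      rw [State.setReg_of_ne _ _ (by omega), State.setReg_same] at hy
      obtain rfl : x = y := by omega
      rw [State.setReg_same]
  -- A negative register 42 is the sentinel `-1`: no admissible position so far, hence any one is
  -- best.
  refine WP.ite trivial ?_ (fun h => hupd ?_) (fun h => ?_)
  · simp only [Expr.Fits]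
    rw [abs_of_nonneg le_rfl]; omega
  · simp only [Expr.val, h42] at h
    intro y hy
    rcases hs.best with ⟨-, h'⟩ | ⟨z, hz, -⟩
    · exact absurd hy (h' y)
    · omega
  simp only [Expr.val, h42] at h
  rcases hs.best with ⟨h', -⟩ | ⟨z, hz, hz2, hz3⟩
  · omega
  have hval := hs.value z hz
  refine WP.ite trivial trivial (fun h => hupd ?_) (fun h => WP.skip ?_)
  · simp only [Expr.val, h46, h41, hval] at h
    exact fun y hy => (hz3 y hy).trans h.le
  · simp only [Expr.val, h46, h41, hval, not_lt] at h
    refine fin s3 rfl ?_ ?_ ?_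
    · intro y hy1 hy2 hy3 hy4
      rw [hs3, State.setReg_of_ne _ _ hy2, hregs2 _ hy1]
    · rw [h42]
      refine Or.inr ⟨z, hz, (hscan z).2 (Or.inl hz2), fun y hy => ?_⟩
      rcases (hscan y).1 hy with hy | rfl
      · exact hz3 y hy
      · exact h
    · rw [h42, h46]
      exact hs.value

/-- Scans all positions, for fixed positions of the edges `α` and `β`. -/
def scan (τ : ℕ) : Program :=
  .seq (.assign (31 + S.γ) (.const 0)) (.seq (.assign (31 + v) (.const 0))
    (.seq (.assign 42 (.const (-1)))
      (.forLoop 43 (.add (.var 36) (.const 1)) (S.scanBody τ))))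

/-- Computes the table number `τ`. -/
def tableProgram (τ : ℕ) : Program :=
  .forLoop (31 + S.α) (.var 36) (.forLoop (31 + S.β) (.var 36) (S.scan τ))

theorem scan_writes {τ x : ℕ} (h : (S.scan τ).Writes x) :
    x = 31 + u ∨ x = 31 + v ∨ x = 31 + S.γ ∨ x = 41 ∨ x = 42 ∨ x = 43 ∨ x = 46 := by
  simp only [scan, Program.forLoop, Program.Writes] at h
  have := S.scanBody_writes (τ := τ) (x := x)
  tauto

theorem tableProgram_writes {τ x : ℕ} (h : (S.tableProgram τ).Writes x) :
    (31 ≤ x ∧ x ≤ 35) ∨ x = 41 ∨ x = 42 ∨ x = 43 ∨ x = 46 := by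
  simp only [tableProgram, Program.forLoop, Program.Writes] at h
  have key : x = 31 + S.α ∨ x = 31 + S.β ∨ (S.scan τ).Writes x ∨ x = 43 := by tauto
  have hα := S.α.2
  have hβ := S.β.2
  have hγ := S.γ.2
  have hu := u.2
  have hv := v.2
  rcases key with h | h | h | h
  · omega
  · omega
  · have := S.scan_writes h
    omega
  · omega

theorem scan_spec (hL : Layout n B b M) {τ a c : ℕ} (hτ1 : 1 ≤ τ) (hτ : τ ≤ 2)
    (ha : a < n) (hc : c < n) {s : State} (hs : Ready n M s) (hsa : s.reg (31 + S.α) = a)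
    (hsc : s.reg (31 + S.β) = c) :
    WP n B (S.scan τ) s fun t => Ready n M t ∧
      (∀ j ≤ n, S.IsBest (tourDist n M) n a c j (t.mem (address n τ a c j))) ∧
      ∀ x, (∀ j ≤ n, x ≠ address n τ a c j) → t.mem x = s.mem x := by
  obtain ⟨huv, huα, huβ, huγ, hvα, hvβ, hvγ, hαβ, hαγ, hβγ⟩ := S.ne
  have hcube := hL.le_cube
  have hα5 := S.α.2
  have hβ5 := S.β.2
  have hγ5 := S.γ.2
  have hu5 := u.2
  have hv5 := v.2
  refine WP.seq (WP.assign ?_ (WP.seq (WP.assign ?_ (WP.seq (WP.assign ?_ ?_)))))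
  · simp [Expr.Fits]
  · simp [Expr.Fits]
  · simp only [Expr.Fits, abs_neg, abs_one]; omega
  simp only [Expr.val]
  -- Each round stores before it compares, so `n + 1` rounds give the optima of all initial segments
  -- of length `0, …, n`. The value scanned in the last round is `n` or `-1` and is rejected by the
  -- tests.
  refine WP.forLoop (n + 1) (S.ScanInv n M τ a c s.mem) le_rfl (by omega) ?_ ?_ ?_ ?_ ?_
  · intro h
    have := S.scanBody_writes h
    omega
  · intro i t ht
    simp only [Expr.Fits, Expr.val, ht.ready.reg_n, true_and]
    refine ⟨⟨?_, ?_⟩, by push_cast; ring⟩ <;> rw [abs_of_nonneg (by omega)] <;> omega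
  · refine ⟨?_, ?_, ?_, ?_, ?_, ?_⟩
    · exact (((hs.setReg _ (by omega) (by omega) (by omega)).setReg _ (by omega) (by omega)
        (by omega)).setReg _ (by omega) (by omega) (by omega)).setReg _ (by omega) (by omega)
        (by omega)
    · intro j hj
      have hj5 := j.2
      rw [State.setReg_of_ne _ _ (by omega), State.setReg_of_ne _ _ (by omega)]
      have hcov := S.cover j
      simp only [State.setReg_reg, Nat.add_left_cancel_iff, Fin.val_inj]
      rcases hcov with rfl | rfl | rfl | rfl | rfl
      · exact absurd rfl hj
      · simp [base, hvα, hvβ]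
      · rw [if_neg hvα.symm, if_neg hαγ, hsa, S.base_α]
      · rw [if_neg hvβ.symm, if_neg hβγ, hsc, S.base_β]
      · simp [base, hαγ.symm, hβγ.symm]
    · rw [State.setReg_of_ne _ _ (by omega), State.setReg_same]
      exact S.isBest_zero ..
    · intro x hx
      rw [State.setReg_of_ne _ _ (by omega), State.setReg_same] at hx
      omega
    · intro j hj
      omega
    · intro x _
      rfl
  · intro i hi t ht h43
    exact S.scanBody_spec hL hτ1 hτ ha hc hi ht h43
  · intro t ht _
    exact ⟨ht.ready, fun j hj => ht.table j (by omega), ht.rest⟩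

/-- The table number `τ` has been computed. -/
def TableReady (n : ℕ) (M : ℕ → ℤ) (τ : ℕ) (m : ℕ → ℤ) : Prop :=
  ∀ a < n, ∀ c < n, ∀ j ≤ n, S.IsBest (tourDist n M) n a c j (m (address n τ a c j))

theorem tableProgram_spec (hL : Layout n B b M) {τ : ℕ} (hτ1 : 1 ≤ τ) (hτ : τ ≤ 2) {s : State}
    (hs : Ready n M s) :
    WP n B (S.tableProgram τ) s fun t => Ready n M t ∧ S.TableReady n M τ t.mem ∧
      ∀ x, ¬ (τ * (n + 2) ^ 3 ≤ x ∧ x < (τ + 1) * (n + 2) ^ 3) → t.mem x = s.mem x := by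
  obtain ⟨huv, huα, huβ, huγ, hvα, hvβ, hvγ, hαβ, hαγ, hβγ⟩ := S.ne
  have hcube := hL.le_cube
  have hα5 := S.α.2
  have hβ5 := S.β.2
  have hγ5 := S.γ.2
  have hu5 := u.2
  have hv5 := v.2
  have hαβ' : (S.α : ℕ) ≠ S.β := fun h => hαβ (Fin.ext h)
  have huα' : (u : ℕ) ≠ S.α := fun h => huα (Fin.ext h)
  have huβ' : (u : ℕ) ≠ S.β := fun h => huβ (Fin.ext h)
  have hvα' : (v : ℕ) ≠ S.α := fun h => hvα (Fin.ext h)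
  have hvβ' : (v : ℕ) ≠ S.β := fun h => hvβ (Fin.ext h)
  have hαγ' : (S.α : ℕ) ≠ S.γ := fun h => hαγ (Fin.ext h)
  have hβγ' : (S.β : ℕ) ≠ S.γ := fun h => hβγ (Fin.ext h)
  -- Entries are complete for all pairs lexicographically before `(a, c)`; no cell outside the block
  -- of the table has changed.
  let J : ℕ → ℕ → State → Prop := fun a c t => Ready n M t ∧
    (∀ a' < n, ∀ c' < n, a' < a ∨ (a' = a ∧ c' < c) → ∀ j ≤ n,
      S.IsBest (tourDist n M) n a' c' j (t.mem (address n τ a' c' j))) ∧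
    ∀ x, ¬ (τ * (n + 2) ^ 3 ≤ x ∧ x < (τ + 1) * (n + 2) ^ 3) → t.mem x = s.mem x
  have hset : ∀ {a c t} (x : ℕ) (z : ℤ), x ≠ 30 → x ≠ 36 → x ≠ 45 → J a c t → J a c (t.setReg x z) :=
    fun x z h1 h2 h3 hJ => ⟨hJ.1.setReg z h1 h2 h3, hJ.2⟩
  have hhi : ∀ {a c t}, J a c t → (Expr.var 36).Fits B t ∧ (Expr.var 36).val t = n :=
    fun hJ => ⟨trivial, hJ.1.reg_n⟩
  refine WP.forLoop n (fun a t => J a 0 t) (by omega) (by omega) ?_ (fun _ _ h => hhi h) ?_ ?_ ?_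
  · intro h
    simp only [Program.forLoop, Program.Writes] at h
    have key : (31 + S.α : ℕ) = 31 + S.β ∨ (S.scan τ).Writes (31 + S.α) := by tauto
    rcases key with h | h
    · omega
    · have := S.scan_writes h
      omega
  · exact hset _ _ (by omega) (by omega) (by omega)
      ⟨hs, fun a' _ c' _ h => by omega, fun _ _ => rfl⟩
  · intro a ha t ht hta
    refine WP.forLoop n (fun c t => J a c t ∧ t.reg (31 + S.α) = a) (by omega) (by omega) ?_
      (fun _ _ h => hhi h.1) ?_ ?_ ?_
    · intro h
      have := S.scan_writes h
      omega
    · exact ⟨hset _ _ (by omega) (by omega) (by omega) ht, by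
        rw [State.setReg_of_ne _ _ (by omega), hta]⟩
    · intro c hc t ht htc
      refine (S.scan_spec hL hτ1 hτ ha hc ht.1.1 ht.2 htc).mono ?_
      rintro t' ⟨h1, h2, h3⟩ hreg -
      refine ⟨hset _ _ (by omega) (by omega) (by omega) ⟨h1, ?_, ?_⟩, ?_⟩
      · intro a' ha' c' hc' hlt j hj
        by_cases heq : a' = a ∧ c' = c
        · obtain ⟨rfl, rfl⟩ := heq
          exact h2 j hj
        · rw [h3]
          · exact ht.1.2.1 a' ha' c' hc' (by omega) j hj
          · intro k hk hadr
            have := address_inj (by omega) (by omega) (by omega) (by omega) hadr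
            omega
      · intro x hx
        rw [h3 x, ht.1.2.2 x hx]
        rintro j hj rfl
        exact hx (address_lt (by omega) (by omega) (by omega))
      · rw [State.setReg_of_ne _ _ (by omega), hreg, ht.2]
        intro h
        have := S.scan_writes h
        omega
    · rintro t ⟨ht, hta⟩ -
      refine hset _ _ (by omega) (by omega) (by omega) ⟨ht.1, ?_, ht.2.2⟩
      intro a' ha' c' hc' hlt
      exact ht.2.1 a' ha' c' hc' (by omega)
  · intro t ht _
    exact ⟨ht.1, fun a ha c hc => ht.2.1 a ha c hc (Or.inl ha), ht.2.2⟩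

end Side

end KOpt

namespace KOpt
open RAM

/-! ### The search for the best move with a given reconnection -/

section
variable {n B b : ℕ} {M : ℕ → ℤ}

/-- Executes `p` if the registers `30, 31, …, 30 + k` are increasing. -/
def guards : ℕ → Program → Program
  | 0, p => p
  | k + 1, p => guards k (.ite (.var (30 + k)) (.var (30 + k + 1)) p .skip)

theorem guards_writes {k x : ℕ} {p : Program} : (guards k p).Writes x ↔ p.Writes x := by
  induction k generalizing p with
  | zero => rfl
  | succ k ih => simp [guards, ih, Program.Writes]

theorem guards_stores {k : ℕ} {p : Program} : (guards k p).Stores ↔ p.Stores := by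
  induction k generalizing p with
  | zero => rfl
  | succ k ih => simp [guards, ih, Program.Stores]

theorem guards_depth {k : ℕ} {p : Program} : (guards k p).depth = p.depth := by
  induction k generalizing p with
  | zero => rfl
  | succ k ih => simp [guards, ih, Program.depth]

theorem guards_spec {k : ℕ} {p : Program} {s : State} {Q : State → Prop}
    (h1 : (∀ j < k, s.reg (30 + j) < s.reg (30 + j + 1)) → WP n B p s Q)
    (h2 : ¬ (∀ j < k, s.reg (30 + j) < s.reg (30 + j + 1)) → Q s) : WP n B (guards k p) s Q := by
  induction k generalizing p with
  | zero => exact h1 fun j hj => absurd hj (Nat.not_lt_zero j)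
  | succ k ih =>
    refine ih (fun h => WP.ite trivial trivial (fun hk => h1 fun j hj => ?_)
      fun hk => WP.skip (h2 fun h' => hk (h' k (Nat.lt_succ_self k)))) fun h => h2 fun h' =>
        h fun j hj => h' j (by omega)
    rcases Nat.lt_succ_iff_lt_or_eq.1 hj with hj | rfl
    · exact h j hj
    · exact hk

/-- The slot whose vertex is the `j`-th output: first the ends of the removed edges, then those of
the added edges. -/
def outputSlot (φ : Equiv.Perm Slot) (j : ℕ) : Slot :=
  if j < 10 then (Fin.ofNat 5 (j / 2), decide (j % 2 = 1))
  -- As 10 is even, the parity of `j` still selects the end of the added edge.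
  else φ (Fin.ofNat 5 ((j - 10) / 2), decide (j % 2 = 1))

/-- Writes the first `k` outputs. -/
def outputs (φ : Equiv.Perm Slot) : ℕ → Program
  | 0 => .skip
  | k + 1 => .seq (outputs φ k) (.assign (1 + k) (slotExpr (outputSlot φ k)))

theorem outputs_writes {φ : Equiv.Perm Slot} {k x : ℕ} (h : (outputs φ k).Writes x) :
    1 ≤ x ∧ x ≤ k := by
  induction k with
  | zero => exact h.elim
  | succ k ih =>
    rcases h with h | h
    · have := ih h
      omega
    · simp only [Program.Writes] at h
      omega

theorem outputs_stores {φ : Equiv.Perm Slot} {k : ℕ} : ¬ (outputs φ k).Stores := by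
  induction k with
  | zero => exact id
  | succ k ih =>
    rintro (h | h)
    · exact ih h
    · exact h

theorem outputs_depth {φ : Equiv.Perm Slot} {k : ℕ} : (outputs φ k).depth = 0 := by
  induction k with
  | zero => rfl
  | succ k ih => simp [outputs, Program.depth, ih]

theorem outputs_spec (hL : Layout n B b M) {φ : Equiv.Perm Slot} {k : ℕ} (hk : k ≤ 20) {s : State}
    (hs : Ready n M s) {p : Fin 5 → ℕ} (hp : ∀ i : Fin 5, s.reg (31 + i) = p i)
    (hn : ∀ i, p i < n) :
    WP n B (outputs φ k) s fun t => ∀ j < k, t.reg (1 + j) = M (slotPos p (outputSlot φ j)) := by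
  induction k with
  | zero => exact WP.skip fun j hj => absurd hj (Nat.not_lt_zero j)
  | succ k ih =>
    refine WP.seq ((ih (by omega)).mono ?_)
    intro t ht hreg hmem
    have hw : ∀ x, 20 < x → t.reg x = s.reg x := fun x hx => hreg x fun h => by
      have := outputs_writes h
      omega
    have hmem' := hmem outputs_stores
    have hrt : Ready n M t := hs.of_eq (hw _ (by omega)) (hw _ (by omega)) (hw _ (by omega))
      fun a _ => by rw [hmem']
    obtain ⟨h1, h2⟩ := slotExpr_spec (a := outputSlot φ k) hL hrt
      ((hw _ (by omega)).trans (hp _)) (hn _)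
    refine WP.assign h1 fun j hj => ?_
    rw [h2]
    rcases Nat.lt_succ_iff_lt_or_eq.1 hj with hj | rfl
    · rw [State.setReg_of_ne _ _ (by omega), ht j hj]
    · rw [State.setReg_same]

/-- The registers `0, …, 20` and `40` hold a valid reconnection that is best among all those with the
property `D`. -/
def BestSoFar (n : ℕ) (M : ℕ → ℤ) (D : Equiv.Perm Slot → (Fin 5 → ℕ) → Prop) (s : State) : Prop :=
  (s.reg 0 = 0 ∧ ∀ φ p, D φ p → ¬ Increasing n p) ∨
  (s.reg 0 = 1 ∧ ∃ φ p, ValidPattern φ ∧ Increasing n p ∧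
    s.reg 40 = patternGain (tourDist n M) φ p ∧
    (∀ j < 20, s.reg (1 + j) = M (slotPos p (outputSlot φ j))) ∧
    ∀ φ' p', D φ' p' → Increasing n p' → patternGain (tourDist n M) φ' p' ≤ s.reg 40)

theorem BestSoFar.mono {D D' : Equiv.Perm Slot → (Fin 5 → ℕ) → Prop} {s t : State}
    (h : BestSoFar n M D s) (hD : ∀ φ p, Increasing n p → D' φ p → D φ p)
    (hst : ∀ x, x ≤ 20 ∨ x = 40 → t.reg x = s.reg x) : BestSoFar n M D' t := by
  unfold BestSoFar
  rw [hst 0 (by omega), hst 40 (by omega)]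
  rcases h with ⟨h1, h2⟩ | ⟨h1, φ, p, h2, h3, h4, h5, h6⟩
  · exact Or.inl ⟨h1, fun φ p hp hi => h2 φ p (hD φ p hi hp) hi⟩
  · refine Or.inr ⟨h1, φ, p, h2, h3, h4, fun j hj => ?_, fun φ' p' hp hi =>
      h6 φ' p' (hD _ _ hi hp) hi⟩
    rw [hst _ (by omega), h5 j hj]

/-- Writes the current move to the output. -/
def record (φ : Equiv.Perm Slot) : Program :=
  .seq (.assign 0 (.const 1)) (.seq (.assign 40 (.var 41)) (outputs φ 20))

/-- Compares the gain of the current move with the best one, and records the move if it is better. -/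
def evaluate (φ : Equiv.Perm Slot) : Program :=
  .seq (.assign 41 (gainExpr φ))
    (.ite (.var 0) (.const 1) (record φ) (.ite (.var 40) (.var 41) (record φ) .skip))

theorem evaluate_writes {φ : Equiv.Perm Slot} {x : ℕ} (h : (evaluate φ).Writes x) :
    x ≤ 20 ∨ x = 40 ∨ x = 41 := by
  simp only [evaluate, record, Program.Writes] at h
  have key : x = 0 ∨ x = 40 ∨ x = 41 ∨ (outputs φ 20).Writes x := by tauto
  rcases key with h | h | h | h
  · omega
  · omega
  · omega
  · have := outputs_writes h
    omega

theorem evaluate_stores {φ : Equiv.Perm Slot} : ¬ (evaluate φ).Stores := by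
  have := outputs_stores (φ := φ) (k := 20)
  simp only [evaluate, record, Program.Stores]
  tauto

/-- The covered set grows by everything that the current move dominates, not just by the move
itself. This is how one evaluation settles all positions of `u` and `v` at once. -/
theorem evaluate_spec (hL : Layout n B b M) {φ : Equiv.Perm Slot} (hφ : ValidPattern φ)
    {D : Equiv.Perm Slot → (Fin 5 → ℕ) → Prop} {s : State} (hs : Ready n M s)
    (hbest : BestSoFar n M D s) {p : Fin 5 → ℕ} (hp : ∀ i : Fin 5, s.reg (31 + i) = p i)
    (hn : Increasing n p) :
    WP n B (evaluate φ) s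
      (BestSoFar n M fun φ' p' => D φ' p' ∨
        patternGain (tourDist n M) φ' p' ≤ patternGain (tourDist n M) φ p) := by
  have hcube := hL.le_cube
  obtain ⟨hgf, hgv⟩ := gainExpr_spec hL hs hp hn.lt φ
  refine WP.seq (WP.assign hgf ?_)
  rw [hgv]
  set g := patternGain (tourDist n M) φ p with hg
  set s1 := s.setReg 41 g with hs1
  have h1 : ∀ x, x ≠ 41 → s1.reg x = s.reg x := fun x hx => s.setReg_of_ne _ hx
  have h41 : s1.reg 41 = g := s.setReg_same ..
  have hr1 : Ready n M s1 := hs.setReg _ (by omega) (by omega) (by omega)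
  have hrec : (∀ φ' p', D φ' p' → Increasing n p' → patternGain (tourDist n M) φ' p' ≤ g) →
      WP n B (record φ) s1 (BestSoFar n M fun φ' p' => D φ' p' ∨
        patternGain (tourDist n M) φ' p' ≤ g) := by
    intro hle
    refine WP.seq (WP.assign ?_ (WP.seq (WP.assign trivial ?_)))
    · simp only [Expr.Fits, abs_one]; omega
    simp only [Expr.val]
    rw [State.setReg_of_ne _ _ (by omega), h41]
    set s3 := (s1.setReg 0 1).setReg 40 g with hs3
    have hr3 : Ready n M s3 := (hr1.setReg _ (by omega) (by omega) (by omega)).setReg _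
      (by omega) (by omega) (by omega)
    refine (outputs_spec hL le_rfl hr3 (p := p) ?_ hn.lt).mono ?_
    · intro i
      have := i.2
      rw [hs3, State.setReg_of_ne _ _ (by omega), State.setReg_of_ne _ _ (by omega),
        h1 _ (by omega), hp]
    · intro t ht hreg _
      have hw : ∀ x, x < 1 ∨ 20 < x → t.reg x = s3.reg x := fun x hx => hreg x fun h => by
        have := outputs_writes h
        omega
      refine Or.inr ⟨?_, φ, p, hφ, hn, ?_, ht, ?_⟩
      · rw [hw _ (by omega), hs3, State.setReg_of_ne _ _ (by omega), State.setReg_same]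
      · rw [hw _ (by omega), hs3, State.setReg_same]
      · intro φ' p' h hi
        rw [hw _ (by omega), hs3, State.setReg_same]
        rcases h with h | h
        · exact hle φ' p' h hi
        · exact h
  refine WP.ite trivial ?_ (fun h => hrec ?_) fun h => ?_
  · simp only [Expr.Fits, abs_one]; omega
  · simp only [Expr.val, h1 0 (by omega)] at h
    rcases hbest with ⟨-, h2⟩ | ⟨h2, -⟩
    · exact fun φ' p' hD hi => absurd hi (h2 φ' p' hD)
    · omega
  simp only [Expr.val, h1 0 (by omega)] at h
  rcases hbest with ⟨h2, -⟩ | ⟨h2, φ₀, p₀, h3, h4, h5, h6, h7⟩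
  · omega
  refine WP.ite trivial trivial (fun h => hrec ?_) fun h => WP.skip ?_
  · simp only [Expr.val, h1 40 (by omega), h41] at h
    exact fun φ' p' hD hi => (h7 φ' p' hD hi).trans h.le
  · simp only [Expr.val, h1 40 (by omega), h41, not_lt] at h
    refine Or.inr ⟨?_, φ₀, p₀, h3, h4, ?_, fun j hj => ?_, fun φ' p' hD hi => ?_⟩
    · rw [h1 _ (by omega), h2]
    · rw [h1 _ (by omega), h5]
    · rw [h1 _ (by omega), h6 j hj]
    · rw [h1 _ (by omega)]
      rcases hD with hD | hD
      · exact h7 φ' p' hD hi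
      · exact hD.trans h

end

/-! ### Reading the tables -/

namespace Side
variable {φ : Equiv.Perm Slot} {u v : Fin 5} (S : Side φ u v)
variable {n B b : ℕ} {M : ℕ → ℤ}

/-- The expression for the last index of the table entry to be used. -/
def readExpr : Expr :=
  if S.up then .var (30 + (u + 2)) else .sub (.sub (.var 36) (.const 1)) (.var (30 + u))

/-- Reads the best position for the `u`-th removed edge. -/
def readBest (τ : ℕ) : Program :=
  .assign (31 + u) (.load (addressExpr τ S.α S.β S.readExpr))

/-- The index uses the position of an order neighbour of `u`, which is never `v`. Here
non-consecutiveness makes the two choices independent. -/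
theorem readIndex_congr {p q : Fin 5 → ℕ} (h1 : (u : ℕ) + 1 ≠ v) (h2 : (v : ℕ) + 1 ≠ u)
    (h : ∀ i, i ≠ u → i ≠ v → p i = q i) : S.readIndex n p = S.readIndex n q := by
  unfold readIndex
  split_ifs
  · exact bound_congr n fun i hi => h i (by rintro rfl; omega) (by rintro rfl; omega)
  · rw [bound_congr n fun i hi => h i (by rintro rfl; omega) (by rintro rfl; omega)]

theorem readBest_spec (hL : Layout n B b M) (h1 : (u : ℕ) + 1 ≠ v) (h2 : (v : ℕ) + 1 ≠ u) {τ : ℕ}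
    (hτ : τ ≤ 2) {s : State} (hs : Ready n M s) {q : Fin 5 → ℕ}
    (hq : ∀ i, i ≠ u → i ≠ v → s.reg (31 + i) = q i ∧ q i < n)
    (htab : S.TableReady n M τ s.mem) {Q : State → Prop}
    (h : ∀ z, (∃ j : ℕ, S.readIndex n q = j ∧
      S.IsBest (tourDist n M) n (q S.α) (q S.β) j z) → Q (s.setReg (31 + u) z)) :
    WP n B (S.readBest τ) s Q := by
  obtain ⟨huv, huα, huβ, huγ, hvα, hvβ, hvγ, hαβ, hαγ, hβγ⟩ := S.ne
  have hcube := hL.le_cube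
  have hu5 := u.2
  have hreg : ∀ j : ℕ, j ≤ 6 → j ≠ u + 1 → j ≠ v + 1 → s.reg (30 + j) = bound n q j := by
    intro j hj hju hjv
    refine hs.reg_bound hj fun i hi => (hq i ?_ ?_).1
    · rintro rfl; omega
    · rintro rfl; omega
  have hrange : ∀ j : ℕ, j ≤ 6 → j ≠ u + 1 → j ≠ v + 1 →
      (j ≠ 0 → 0 ≤ bound n q j) ∧ -1 ≤ bound n q j ∧ bound n q j ≤ n ∧
        (j ≠ 6 → bound n q j ≤ n - 1) := by
    have hn := hL.pos
    intro j hj hju hjv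
    by_cases h0 : j = 0
    · subst h0
      simp only [bound]
      omega
    by_cases h6 : j = 6
    · subst h6
      simp only [bound]
      omega
    obtain ⟨i, rfl⟩ : ∃ i : Fin 5, j = i + 1 := ⟨⟨j - 1, by omega⟩, by simp only; omega⟩
    rw [bound_succ]
    have := (hq i (by rintro rfl; omega) (by rintro rfl; omega)).2
    omega
  have hread : S.readExpr.Fits B s ∧ S.readExpr.val s = S.readIndex n q ∧
      0 ≤ S.readIndex n q ∧ S.readIndex n q ≤ n := by
    have hn := hL.pos
    unfold readExpr readIndex
    split_ifs
    · have h3 := hrange (u + 2) (by omega) (by omega) (by omega)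
      exact ⟨trivial, hreg _ (by omega) (by omega) (by omega), h3.1 (by omega), h3.2.2.1⟩
    · have h3 := hrange u (by omega) (by omega) (by omega)
      have h4 := h3.2.2.2 (by omega)
      simp only [Expr.Fits, Expr.val, hs.reg_n, hreg u (by omega) (by omega) (by omega), true_and]
      refine ⟨⟨⟨?_, ?_⟩, ?_⟩, by omega, by omega⟩
      all_goals
        rw [abs_le]
        constructor <;> omega
  obtain ⟨j, hj⟩ := Int.eq_ofNat_of_zero_le hread.2.2.1
  have hα := hq S.α huα.symm hvα.symm
  have hβ := hq S.β huβ.symm hvβ.symm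
  obtain ⟨hf, hv⟩ := addressExpr_spec hL hs hτ hα.1 hβ.1 hα.2 hβ.2 hread.1
    (hread.2.1.trans hj) (by omega)
  refine WP.assign ⟨hf, by rw [hv]; omega⟩ (h _ ⟨j, hj, ?_⟩)
  simp only [Expr.val]
  rw [hv, Int.toNat_natCast]
  exact htab _ hα.2 _ hβ.2 j (by omega)

end Side

/-! ### The search over the three remaining positions -/

section
variable {φ : Equiv.Perm Slot} {u v : Fin 5} (S : Side φ u v) (S' : Side φ v u)
variable {n B b : ℕ} {M : ℕ → ℤ}

/-- Treats the best move for given positions of the removed edges other than `u` and `v`. -/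
def searchBody : Program :=
  .seq (S.readBest 1) (.seq (S'.readBest 2) (guards 6 (evaluate φ)))

/-- Searches for the best move for the reconnection `φ`. -/
def searchProgram : Program :=
  .seq (S.tableProgram 1) (.seq (S'.tableProgram 2)
    (.forLoop (31 + S.α) (.var 36) (.forLoop (31 + S.β) (.var 36)
      (.forLoop (31 + S.γ) (.var 36) (searchBody S S')))))

theorem searchBody_writes {x : ℕ} (h : (searchBody S S').Writes x) :
    x = 31 + u ∨ x = 31 + v ∨ x ≤ 20 ∨ x = 40 ∨ x = 41 := by
  simp only [searchBody, Side.readBest, Program.Writes, guards_writes] at h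
  have := evaluate_writes (φ := φ) (x := x)
  tauto

theorem searchBody_stores : ¬ (searchBody S S').Stores := by
  have := evaluate_stores (φ := φ)
  simp only [searchBody, Side.readBest, Program.Stores, guards_stores]
  tauto

/-- Each table takes two loops and a scan, the search takes three loops, and its body is loop-free.
-/
theorem searchProgram_depth : (searchProgram S S').depth ≤ 3 := by
  simp [searchProgram, searchBody, Side.tableProgram, Side.scan, Side.scanBody, Side.compareBest,
    Side.updateBest, Side.readBest, Program.forLoop, Program.depth, guards_depth, evaluate, record,
    outputs_depth]

/-- Any increasing `p` with the given three positions is improved first at `u`, then at `v`, to the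
vector formed by the two table values. So that single vector dominates all such `p`. -/
theorem searchBody_spec (hL : Layout n B b M) (hφ : ValidPattern φ) (h1 : (u : ℕ) + 1 ≠ v)
    (h2 : (v : ℕ) + 1 ≠ u) {D : Equiv.Perm Slot → (Fin 5 → ℕ) → Prop} {s : State}
    (hs : Ready n M s) (hbest : BestSoFar n M D s) (ht1 : S.TableReady n M 1 s.mem)
    (ht2 : S'.TableReady n M 2 s.mem) {q : Fin 5 → ℕ}
    (hq : ∀ i, i ≠ u → i ≠ v → s.reg (31 + i) = q i ∧ q i < n) :
    WP n B (searchBody S S') s (BestSoFar n M fun φ' p =>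
      D φ' p ∨ (φ' = φ ∧ ∀ i, i ≠ u → i ≠ v → p i = q i)) := by
  obtain ⟨huv, huα, huβ, huγ, hvα, hvβ, hvγ, hαβ, hαγ, hβγ⟩ := S.ne
  obtain ⟨-, hvα', hvβ', hvγ', huα', huβ', huγ', -⟩ := S'.ne
  have hu5 := u.2
  have hv5 := v.2
  have huv' : (u : ℕ) ≠ v := fun h => huv (Fin.ext h)
  refine WP.seq (S.readBest_spec hL h1 h2 (by omega) hs hq ht1 fun z hz => ?_)
  have hs1 : Ready n M (s.setReg (31 + u) z) := hs.setReg _ (by omega) (by omega) (by omega)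
  have hq1 : ∀ i, i ≠ v → i ≠ u → (s.setReg (31 + u) z).reg (31 + i) = q i ∧ q i < n := by
    intro i hiv hiu
    have : (i : ℕ) ≠ u := fun h => hiu (Fin.ext h)
    rw [State.setReg_of_ne _ _ (by omega)]
    exact hq i hiu hiv
  refine WP.seq (S'.readBest_spec hL h2 h1 (by omega) hs1 hq1 ht2 fun z' hz' => ?_)
  set s2 := (s.setReg (31 + u) z).setReg (31 + v) z' with hs2
  have hr2 : Ready n M s2 := hs1.setReg _ (by omega) (by omega) (by omega)
  have hreg2 : ∀ i : Fin 5, s2.reg (31 + i) = if i = v then z' else if i = u then z else q i := by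
    intro i
    rw [hs2, State.setReg_reg, State.setReg_reg]
    simp only [Nat.add_left_cancel_iff, Fin.val_inj]
    split_ifs with h3 h4
    · rfl
    · rfl
    · exact (hq i h4 h3).1
  -- The vector `p'` is the content of the registers, whatever `p` is; its existence also shows that
  -- the guards pass whenever there is a competitor.
  have hdom : ∀ p, Increasing n p → (∀ i, i ≠ u → i ≠ v → p i = q i) →
      ∃ p', Increasing n p' ∧ (∀ i : Fin 5, s2.reg (31 + i) = p' i) ∧
        patternGain (tourDist n M) φ p ≤ patternGain (tourDist n M) φ p' := by
    intro p hp hpq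
    obtain ⟨j, hj, hz⟩ := hz
    obtain ⟨j', hj', hz'⟩ := hz'
    rw [← S.readIndex_congr h1 h2 hpq] at hj
    rw [← hpq S.α huα.symm hvα.symm, ← hpq S.β huβ.symm hvβ.symm] at hz
    obtain ⟨x, rfl, hx1, hx2, hx3⟩ := hz.improve hp hj
    have hp1 := hp.update hx1 hx2
    set p1 := Function.update p u x with hp1'
    have hp1q : ∀ i, i ≠ v → i ≠ u → p1 i = q i := fun i hiv hiu => by
      rw [hp1', Function.update_of_ne hiu, hpq i hiu hiv]
    rw [← S'.readIndex_congr h2 h1 hp1q] at hj'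
    rw [← hp1q S'.α hvα'.symm huα'.symm, ← hp1q S'.β hvβ'.symm huβ'.symm] at hz'
    obtain ⟨y, rfl, hy1, hy2, hy3⟩ := hz'.improve hp1 hj'
    refine ⟨Function.update p1 v y, hp1.update hy1 hy2, fun i => ?_, hx3.trans hy3⟩
    rw [hreg2]
    by_cases hiv : i = v
    · subst hiv; simp
    · rw [if_neg hiv, Function.update_of_ne hiv]
      by_cases hiu : i = u
      · subst hiu; simp [hp1']
      · rw [if_neg hiu, hp1q i hiv hiu]
  have hbest2 : BestSoFar n M D s2 := hbest.mono (fun _ _ _ h => h) fun x hx => by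
    rw [hs2, State.setReg_of_ne _ _ (by omega), State.setReg_of_ne _ _ (by omega)]
  refine guards_spec (fun hg => ?_) fun hg => ?_
  -- The chain of guards starts at the register 30, which holds `-1`, so the sentinel `-1` read from
  -- a table never passes.
  · have hnonneg : ∀ i : Fin 5, 0 ≤ s2.reg (31 + i) := by
      have g0 := hg 0 (by omega)
      have g1 := hg 1 (by omega)
      have g2 := hg 2 (by omega)
      have g3 := hg 3 (by omega)
      have g4 := hg 4 (by omega)
      have := hr2.reg_minus_one
      simp only [Nat.reduceAdd] at g0 g1 g2 g3 g4
      intro i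
      fin_cases i <;> simp <;> omega
    let p : Fin 5 → ℕ := fun i => (s2.reg (31 + i)).toNat
    have hp : ∀ i : Fin 5, s2.reg (31 + i) = p i := fun i => by
      simp only [p]
      rw [Int.toNat_of_nonneg (hnonneg i)]
    have hinc : Increasing n p := by
      intro j hj
      rw [← hr2.reg_bound (by omega) fun i _ => hp i, ← hr2.reg_bound (by omega) fun i _ => hp i]
      exact hg j hj
    refine (evaluate_spec hL hφ hr2 hbest2 hp hinc).mono fun t ht _ _ => ?_
    refine ht.mono ?_ fun _ _ => rfl
    rintro φ' p' hi (h | ⟨rfl, h⟩)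
    · exact Or.inl h
    · obtain ⟨p'', h3, h4, h5⟩ := hdom p' hi h
      have : p'' = p := funext fun i => by
        have := h4 i
        rw [hp i] at this
        omega
      rw [this] at h5
      exact Or.inr h5
  · refine hbest2.mono ?_ fun _ _ => rfl
    rintro φ' p' hi (h | ⟨rfl, h⟩)
    · exact h
    · exfalso
      obtain ⟨p'', h3, h4, -⟩ := hdom p' hi h
      refine hg fun j hj => ?_
      have := h3 j hj
      rwa [← hr2.reg_bound (by omega) fun i _ => h4 i,
        ← hr2.reg_bound (by omega) fun i _ => h4 i] at this

set_option maxHeartbeats 1600000 in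
theorem searchProgram_spec (hL : Layout n B b M) (hφ : ValidPattern φ) (h1 : (u : ℕ) + 1 ≠ v)
    (h2 : (v : ℕ) + 1 ≠ u) {D : Equiv.Perm Slot → (Fin 5 → ℕ) → Prop} {s : State}
    (hs : Ready n M s) (hbest : BestSoFar n M D s) :
    WP n B (searchProgram S S') s fun t => Ready n M t ∧
      BestSoFar n M (fun φ' p => D φ' p ∨ φ' = φ) t := by
  obtain ⟨huv, huα, huβ, huγ, hvα, hvβ, hvγ, hαβ, hαγ, hβγ⟩ := S.ne
  have hcube := hL.le_cube
  have hα5 := S.α.2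
  have hβ5 := S.β.2
  have hγ5 := S.γ.2
  have hu5 := u.2
  have hv5 := v.2
  have hαβ' : (S.α : ℕ) ≠ S.β := fun h => hαβ (Fin.ext h)
  have huα' : (u : ℕ) ≠ S.α := fun h => huα (Fin.ext h)
  have huβ' : (u : ℕ) ≠ S.β := fun h => huβ (Fin.ext h)
  have huγ' : (u : ℕ) ≠ S.γ := fun h => huγ (Fin.ext h)
  have hvα' : (v : ℕ) ≠ S.α := fun h => hvα (Fin.ext h)
  have hvβ' : (v : ℕ) ≠ S.β := fun h => hvβ (Fin.ext h)
  have hvγ' : (v : ℕ) ≠ S.γ := fun h => hvγ (Fin.ext h)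
  have hαγ' : (S.α : ℕ) ≠ S.γ := fun h => hαγ (Fin.ext h)
  have hβγ' : (S.β : ℕ) ≠ S.γ := fun h => hβγ (Fin.ext h)
  refine WP.seq ((S.tableProgram_spec hL le_rfl (by omega) hs).mono ?_)
  rintro s1 ⟨hr1, htab1, -⟩ hreg1 -
  refine WP.seq ((S'.tableProgram_spec hL (by omega) le_rfl hr1).mono ?_)
  rintro s2 ⟨hr2, htab2, hmem2⟩ hreg2 -
  have htab1' : S.TableReady n M 1 s2.mem := by
    intro a ha c hc j hj
    rw [hmem2]
    · exact htab1 a ha c hc j hj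
    · have := (address_lt (n := n) (τ := 1) (a := a) (c := c) (i := j) (by omega) (by omega)
        (by omega)).2
      omega
  have hbest2 : BestSoFar n M D s2 := hbest.mono (fun _ _ _ h => h) fun x hx => by
    rw [hreg2 x fun h => ?_, hreg1 x fun h => ?_]
    · have := S.tableProgram_writes h; omega
    · have := S'.tableProgram_writes h; omega
  -- The moves with pattern `φ` whose positions at `α`, `β`, `γ` lexicographically precede `(a, c,
  -- e)` are covered.
  let J : ℕ → ℕ → ℕ → State → Prop := fun a c e t => Ready n M t ∧ S.TableReady n M 1 t.mem ∧
    S'.TableReady n M 2 t.mem ∧ BestSoFar n M (fun φ' p => D φ' p ∨ (φ' = φ ∧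
      (p S.α < a ∨ (p S.α = a ∧ (p S.β < c ∨ (p S.β = c ∧ p S.γ < e)))))) t
  have hset : ∀ {a c e t} (x : ℕ) (z : ℤ), 31 ≤ x → x ≤ 35 → J a c e t → J a c e (t.setReg x z) :=
    fun x z h3 h4 hJ => ⟨hJ.1.setReg z (by omega) (by omega) (by omega), hJ.2.1, hJ.2.2.1,
      hJ.2.2.2.mono (fun _ _ _ h => h) fun y hy => State.setReg_of_ne _ _ (by omega)⟩
  have hJmono : ∀ {a c e a' c' e' t}, J a c e t → (∀ p, Increasing n p →
      (p S.α < a' ∨ (p S.α = a' ∧ (p S.β < c' ∨ (p S.β = c' ∧ p S.γ < e')))) →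
      (p S.α < a ∨ (p S.α = a ∧ (p S.β < c ∨ (p S.β = c ∧ p S.γ < e))))) → J a' c' e' t :=
    fun hJ h => ⟨hJ.1, hJ.2.1, hJ.2.2.1, hJ.2.2.2.mono (fun φ' p hi hD => by
      have := h p hi
      tauto) fun _ _ => rfl⟩
  have hhi : ∀ {a c e t}, J a c e t → (Expr.var 36).Fits B t ∧ (Expr.var 36).val t = n :=
    fun hJ => ⟨trivial, hJ.1.reg_n⟩
  refine WP.forLoop n (fun a t => J a 0 0 t) (by omega) (by omega) ?_ (fun _ _ h => hhi h) ?_ ?_ ?_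
  · intro h
    simp only [Program.forLoop, Program.Writes] at h
    have key : (31 + S.α : ℕ) = 31 + S.β ∨ (31 + S.α : ℕ) = 31 + S.γ ∨
      (searchBody S S').Writes (31 + S.α) := by tauto
    rcases key with h | h | h
    · omega
    · omega
    · have := searchBody_writes S S' h
      omega
  · exact hset _ _ (by omega) (by omega) ⟨hr2, htab1', htab2, hbest2.mono (fun φ' p _ h => by
      rcases h with h | ⟨-, h⟩
      · exact h
      · omega) fun _ _ => rfl⟩
  · intro a ha t ht hta
    refine WP.forLoop n (fun c t => J a c 0 t ∧ t.reg (31 + S.α) = a) (by omega) (by omega) ?_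
      (fun _ _ h => hhi h.1) ?_ ?_ ?_
    · intro h
      simp only [Program.forLoop, Program.Writes] at h
      have key : (31 + S.β : ℕ) = 31 + S.γ ∨ (searchBody S S').Writes (31 + S.β) := by tauto
      rcases key with h | h
      · omega
      · have := searchBody_writes S S' h
        omega
    · exact ⟨hset _ _ (by omega) (by omega) ht, by
        rw [State.setReg_of_ne _ _ (by omega), hta]⟩
    · intro c hc t ht htc
      refine WP.forLoop n (fun e t => J a c e t ∧ t.reg (31 + S.α) = a ∧ t.reg (31 + S.β) = c)
        (by omega) (by omega) ?_ (fun _ _ h => hhi h.1) ?_ ?_ ?_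
      · intro h
        have := searchBody_writes S S' h
        omega
      · exact ⟨hset _ _ (by omega) (by omega) ht.1,
          by rw [State.setReg_of_ne _ _ (by omega), ht.2],
          by rw [State.setReg_of_ne _ _ (by omega), htc]⟩
      · rintro e he t ⟨⟨hr, ht1, ht2, hb⟩, hta, htc⟩ hte
        let q : Fin 5 → ℕ := fun i => if i = S.α then a else if i = S.β then c else e
        have hqα : q S.α = a := by simp [q]
        have hqβ : q S.β = c := by simp [q, hαβ.symm]
        have hqγ : q S.γ = e := by simp [q, hαγ.symm, hβγ.symm]
        refine (searchBody_spec S S' hL hφ h1 h2 hr hb ht1 ht2 (q := q) ?_).mono ?_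
        · intro i hiu hiv
          rcases S.cover i with rfl | rfl | rfl | rfl | rfl
          · exact absurd rfl hiu
          · exact absurd rfl hiv
          · rw [hqα]; exact ⟨hta, ha⟩
          · rw [hqβ]; exact ⟨htc, hc⟩
          · rw [hqγ]; exact ⟨hte, he⟩
        · intro t' hb' hreg' hmem'
          have hm := hmem' (searchBody_stores S S')
          have hw : ∀ x : ℕ, x ≠ 31 + u → x ≠ 31 + v → 20 < x → x ≠ 40 → x ≠ 41 →
              t'.reg x = t.reg x := fun x _ _ _ _ _ => hreg' x fun h => by
            have := searchBody_writes S S' h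
            omega
          refine ⟨hset _ _ (by omega) (by omega) ⟨?_, by rwa [hm], by rwa [hm], ?_⟩, ?_, ?_⟩
          · exact hr.of_eq (hw _ (by omega) (by omega) (by omega) (by omega) (by omega))
              (hw _ (by omega) (by omega) (by omega) (by omega) (by omega))
              (hw _ (by omega) (by omega) (by omega) (by omega) (by omega)) fun _ _ => by rw [hm]
          · refine hb'.mono ?_ fun _ _ => rfl
            rintro φ' p - (h | ⟨rfl, h⟩)
            · exact Or.inl (Or.inl h)
            · by_cases hp : p S.α = a ∧ p S.β = c ∧ p S.γ = e
              · refine Or.inr ⟨rfl, fun i hiu hiv => ?_⟩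
                rcases S.cover i with rfl | rfl | rfl | rfl | rfl
                · exact absurd rfl hiu
                · exact absurd rfl hiv
                · rw [hqα, hp.1]
                · rw [hqβ, hp.2.1]
                · rw [hqγ, hp.2.2]
              · exact Or.inl (Or.inr ⟨rfl, by omega⟩)
          · rw [State.setReg_of_ne _ _ (by omega),
              hw _ (by omega) (by omega) (by omega) (by omega) (by omega), hta]
          · rw [State.setReg_of_ne _ _ (by omega),
              hw _ (by omega) (by omega) (by omega) (by omega) (by omega), htc]
      · rintro t ⟨ht, hta, htc⟩ -
        refine ⟨hset _ _ (by omega) (by omega) (hJmono ht ?_), ?_⟩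
        -- A complete inner loop carries over to the next index, because positions are less than
        -- `n`; likewise one level further out.
        · intro p hp h
          have := hp.lt S.γ
          omega
        · rw [State.setReg_of_ne _ _ (by omega), hta]
    · rintro t ⟨ht, hta⟩ -
      refine hset _ _ (by omega) (by omega) (hJmono ht ?_)
      intro p hp h
      have := hp.lt S.β
      omega
  · intro t ht _
    refine ⟨ht.1, ht.2.2.2.mono ?_ fun _ _ => rfl⟩
    rintro φ' p hp (h | h)
    · exact Or.inl h
    · exact Or.inr ⟨h, Or.inl (hp.lt S.α)⟩

end

theorem exists_search {φ : Equiv.Perm Slot} (hφ : ValidPattern φ) :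
    ∃ P : Program, P.depth ≤ 3 ∧ ∀ {n B b : ℕ} {M : ℕ → ℤ}, Layout n B b M →
      ∀ {D : Equiv.Perm Slot → (Fin 5 → ℕ) → Prop} {s : State}, Ready n M s → BestSoFar n M D s →
      WP n B P s fun t => Ready n M t ∧ BestSoFar n M (fun φ' p => D φ' p ∨ φ' = φ) t := by
  obtain ⟨u, v, huv, h⟩ := exists_separated φ
  have h' : ∀ k b, (φ (k, b)).1 = v → (φ (k, !b)).1 ≠ u := by
    intro k b hk hk'
    have := h k (!b) hk'
    rw [Bool.not_not] at this
    exact this hk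
  obtain ⟨S⟩ := exists_side (φ := φ) (u := u) (v := v) (by rintro rfl; omega) (by omega)
    (by omega) h
  obtain ⟨S'⟩ := exists_side (φ := φ) (u := v) (v := u) (by rintro rfl; omega) (by omega)
    (by omega) h'
  exact ⟨searchProgram S S', searchProgram_depth S S', fun hL _ _ hs hb =>
    searchProgram_spec S S' hL hφ (by omega) (by omega) hs hb⟩

end KOpt

namespace KOpt
open RAM

/-! ### The program for `5`-opt Optimization -/

/-! ### From the input memory to gains and answers -/

section
variable {n : ℕ} (I : Instance n)

theorem Instance.weight_le_maxWeight {u v : Fin n} (h : u ≠ v) :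
    I.weight s(u, v) ≤ I.maxWeight :=
  Finset.le_sup (f := I.weight) (by simpa using h)

/-- The memory after the first vertex of the tour has been copied to the cell `n`. -/
def Instance.memory (hn : 0 < n) : ℕ → ℤ :=
  Function.update I.initialState.mem n ((I.tour ⟨0, hn⟩ : Fin n) : ℤ)

theorem Instance.memory_vertex (hn : 0 < n) (x : Fin n) : I.memory hn x = (I.tour x : ℕ) := by
  rw [memory, Function.update_of_ne (by omega)]
  simp [initialState]

theorem Instance.memory_last (hn : 0 < n) : I.memory hn n = (I.tour ⟨0, hn⟩ : ℕ) := by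
  rw [memory, Function.update_self]

theorem Instance.memory_weight (hn : 0 < n) {u v : Fin n} (h : u ≠ v) :
    I.memory hn (n + (n * u + v)) = I.weight s(u, v) := by
  -- The copy of the first vertex overwrites the cell `n`, which belongs to the loop at vertex 0; `u
  -- ≠ v` excludes it.
  have hne : n * (u : ℕ) + v ≠ 0 := by
    intro h0
    have h1 : n * (u : ℕ) = 0 := by omega
    have h2 : (u : ℕ) = 0 := by
      rcases Nat.mul_eq_zero.1 h1 with h1 | h1
      · omega
      · exact h1
    exact h (Fin.ext (by omega))
  have hlt : n * (u : ℕ) + v < n * n := by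
    have h1 : n * ((u : ℕ) + 1) ≤ n * n := Nat.mul_le_mul_left _ u.2
    rw [Nat.mul_add] at h1
    have := v.2
    omega
  have hdiv : (n * (u : ℕ) + v) / n = u := by
    rw [Nat.mul_add_div hn, Nat.div_eq_of_lt v.2, Nat.add_zero]
  have hmod : (n * (u : ℕ) + v) % n = v := by
    rw [Nat.mul_add_mod, Nat.mod_eq_of_lt v.2]
  rw [memory, Function.update_of_ne (by omega)]
  simp only [initialState, Nat.add_sub_cancel_left, hlt, dif_pos, hdiv, hmod, Fin.eta, if_neg h]
  rw [dif_neg (by omega)]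

theorem Instance.memory_cell (hn : 0 < n) (a : ℕ) (ha : a < n + n * n) :
    0 ≤ I.memory hn a ∧ I.memory hn a ≤ (n + I.maxWeight : ℕ) := by
  rcases Nat.lt_trichotomy a n with h | rfl | h
  · have := I.memory_vertex hn ⟨a, h⟩
    have h2 := (I.tour ⟨a, h⟩).2
    simp only at this
    omega
  · have := I.memory_last hn
    have h2 := (I.tour ⟨0, hn⟩).2
    omega
  · have h1 : ¬ a < n := by omega
    have h2 : a - n < n * n := by omega
    rw [memory, Function.update_of_ne (by omega)]
    simp only [initialState, dif_neg h1, dif_pos h2]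
    split_ifs with h3
    · omega
    · have := I.weight_le_maxWeight h3
      omega

/-- The largest numbers are table addresses, below `3 * (n + 2) ^ 3`, and gains, bounded by `10 * x`
with `x = n + W`. Since `x ≥ 3`, both are at most `27 * x ^ 3 ≤ x ^ 6`, whence the exponent 6. -/
theorem Instance.layout (hn : 3 ≤ n) :
    Layout n (I.wordBound 6) (n + I.maxWeight) (I.memory (by omega)) := by
  have h0 : 0 < n := by omega
  set x := n + I.maxWeight with hx
  have hx3 : 3 ≤ x := by omega
  have hB : 27 * x ^ 3 ≤ I.wordBound 6 := by
    calc 27 * x ^ 3 = 3 ^ 3 * x ^ 3 := by norm_num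
      _ ≤ x ^ 3 * x ^ 3 := Nat.mul_le_mul_right _ (Nat.pow_le_pow_left hx3 3)
      _ = x ^ 6 := by ring
  refine ⟨by omega, ?_, fun a ha => I.memory_cell h0 a ha, ?_, ?_⟩
  · intro y hy
    rcases Nat.lt_or_ge y n with h | h
    · have := I.memory_vertex h0 ⟨y, h⟩
      have h2 := (I.tour ⟨y, h⟩).2
      simp only at this
      omega
    · obtain rfl : y = n := by omega
      have := I.memory_last h0
      have h2 := (I.tour ⟨0, h0⟩).2
      omega
  · have : x ≤ x ^ 3 := Nat.le_self_pow (by norm_num) x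
    omega
  · have h1 : (n + 2) ^ 3 ≤ (2 * x) ^ 3 := Nat.pow_le_pow_left (by omega) 3
    have h2 : (2 * x) ^ 3 = 8 * x ^ 3 := by ring
    omega

theorem Instance.memory_slotPos (hn : 3 ≤ n) (p : Fin 5 → Fin n) (a : Slot) :
    I.memory (by omega) (slotPos (fun i => p i) a) = (I.slotVertex p a : ℕ) := by
  obtain ⟨i, c⟩ := a
  cases c
  · simpa [slotPos, slotVertex, dart] using I.memory_vertex (by omega) (p i)
  · have h := finRotate_val (p i)
    simp only [slotPos, slotVertex, dart, Bool.toNat_true, if_true]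
    split_ifs at h with h1
    · rw [← h]
      exact I.memory_vertex _ _
    · have h2 : (p i : ℕ) + 1 = n := by have := (p i).2; omega
      have h3 : finRotate n (p i) = ⟨0, by omega⟩ := Fin.ext h
      rw [h2, h3]
      exact I.memory_last _

theorem Instance.tourDist_eq (hn : 3 ≤ n) (p : Fin 5 → Fin n) {a c : Slot}
    (h : I.slotVertex p a ≠ I.slotVertex p c) :
    tourDist n (I.memory (by omega)) (slotPos (fun i => p i) a) (slotPos (fun i => p i) c) =
      I.weight s(I.slotVertex p a, I.slotVertex p c) := by
  rw [tourDist, I.memory_slotPos hn, I.memory_slotPos hn, Int.toNat_natCast, Int.toNat_natCast]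
  exact I.memory_weight _ h

/-- For a valid pattern the five added edges are distinct and not loops, so sums over the edge sets
are sums over the indices, and only genuine weights are read from the table. -/
theorem Instance.gain_eq (hn : 3 ≤ n) {p : Fin 5 → Fin n} (hp : StrictMono p)
    {φ : Equiv.Perm Slot} (hφ : ValidPattern φ) :
    I.gain (I.removed p) (I.added p φ) =
      patternGain (tourDist n (I.memory (by omega))) φ (fun i => p i) := by
  have hmove := I.isMove_of_validPattern hn hp hφ
  have hinj : Set.InjOn (fun k => s(I.slotVertex p (φ (k, false)), I.slotVertex p (φ (k, true))))
      (Finset.univ : Finset (Fin 5)) := by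
    rw [← Finset.card_image_iff]
    exact hmove.card_added.trans (by simp)
  unfold gain patternGain
  congr 1
  · rw [removed, Finset.sum_image fun i _ j _ h => hp.injective (I.tourEdge_injective hn h)]
    refine Finset.sum_congr rfl fun i _ => ?_
    have h : I.slotVertex p (i, false) ≠ I.slotVertex p (i, true) := I.dart_ne hn (p i)
    rw [I.tourDist_eq hn p h]
    rfl
  · rw [added, Finset.sum_image hinj]
    refine Finset.sum_congr rfl fun k _ => ?_
    rw [I.tourDist_eq hn p]
    have hk := hmove.added_subset (Finset.mem_image_of_mem _ (Finset.mem_univ k))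
    simpa using hk

theorem Instance.holdsEdges_of_reg (hn : 3 ≤ n) {p : Fin 5 → Fin n} {s : State} {r : ℕ}
    {f : Slot → Slot} (h : ∀ (i : Fin 5) (c : Bool), s.reg (r + 2 * i + c.toNat) =
      I.memory (by omega) (slotPos (fun i => p i) (f (i, c)))) :
    HoldsEdges s r 5
      (Finset.univ.image fun i => s(I.slotVertex p (f (i, false)), I.slotVertex p (f (i, true)))) := by
  refine ⟨fun i => I.slotVertex p (f (i, false)), fun i => I.slotVertex p (f (i, true)),
    fun i => ⟨?_, ?_⟩, rfl⟩
  · rw [← I.memory_slotPos hn]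
    exact h i false
  · rw [← I.memory_slotPos hn]
    exact h i true

theorem Instance.isAnswer_of_bestSoFar (hn : 3 ≤ n) {D : Equiv.Perm Slot → (Fin 5 → ℕ) → Prop}
    {s : State} (h : BestSoFar n (I.memory (by omega)) D s) (hD : ∀ φ p, ValidPattern φ → D φ p) :
    I.IsAnswer 5 s := by
  rcases h with ⟨h0, hnone⟩ | ⟨h1, φ, q, hφ, hq, hgain, hout, hbest⟩
  · refine Or.inr ⟨h0, ?_⟩
    rintro ⟨R, A, hmove⟩
    obtain ⟨p, φ, hp, hφ, rfl, rfl⟩ := I.exists_pattern_of_isMove hn hmove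
    exact hnone φ _ (hD _ _ hφ) (increasing_iff.2 ⟨hp, fun i => (p i).2⟩)
  · obtain ⟨p, rfl⟩ : ∃ p : Fin 5 → Fin n, q = fun i => (p i : ℕ) :=
      ⟨fun i => ⟨q i, hq.lt i⟩, rfl⟩
    have hp : StrictMono p := fun i j hij => (increasing_iff.1 hq).1 hij
    refine Or.inl ⟨h1, I.removed p, I.added p φ, ⟨I.isMove_of_validPattern hn hp hφ, ?_⟩, ?_, ?_⟩
    · intro R' A' hmove
      obtain ⟨p', φ', hp', hφ', rfl, rfl⟩ := I.exists_pattern_of_isMove hn hmove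
      rw [I.gain_eq hn hp hφ, I.gain_eq hn hp' hφ', ← hgain]
      exact hbest _ _ (hD _ _ hφ') (increasing_iff.2 ⟨hp', fun i => (p' i).2⟩)
    · refine I.holdsEdges_of_reg hn (f := id) fun i c => ?_
      have hc := Bool.toNat_le c
      have hi := i.2
      have h2 := hout (2 * i + c.toNat) (by omega)
      rw [show 1 + 2 * (i : ℕ) + c.toNat = 1 + (2 * i + c.toNat) by omega, h2]
      congr 2
      fin_cases i <;> cases c <;> rfl
    · refine I.holdsEdges_of_reg hn (f := φ) fun i c => ?_
      have hc := Bool.toNat_le c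
      have hi := i.2
      have h2 := hout (10 + (2 * i + c.toNat)) (by omega)
      rw [show 1 + 2 * 5 + 2 * (i : ℕ) + c.toNat = 1 + (10 + (2 * i + c.toNat)) by omega, h2]
      congr 2
      fin_cases i <;> cases c <;> rfl

/-- Prepares the constant registers and copies the first vertex of the tour to the cell `n`. -/
def prepare : Program :=
  .seq (.store (.var 0) (.load (.const 0))) (.seq (.assign 30 (.const (-1)))
    (.seq (.assign 36 (.var 0)) (.seq (.assign 45 (.add (.var 0) (.const 2)))
      (.assign 0 (.const 0)))))

theorem prepare_spec (hn : 3 ≤ n) :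
    WP n (I.wordBound 6) prepare I.initialState fun t => Ready n (I.memory (by omega)) t ∧
      BestSoFar n (I.memory (by omega)) (fun _ _ => False) t := by
  have hcube := (I.layout hn).le_cube
  have h0 : I.initialState.reg 0 = n := rfl
  have hmem : I.initialState.mem 0 = ((I.tour ⟨0, by omega⟩ : Fin n) : ℤ) := by
    simp [Instance.initialState, show 0 < n by omega]
  refine WP.seq (WP.store n trivial h0 ⟨?_, le_rfl⟩ (WP.seq (WP.assign ?_ (WP.seq
    (WP.assign trivial (WP.seq (WP.assign ⟨trivial, ?_, ?_⟩ (WP.assign ?_ ?_))))))))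
  · simp [Expr.Fits]
  · simp only [Expr.Fits, abs_neg, abs_one]; omega
  · simp only [Expr.Fits]
    rw [abs_of_nonneg (by omega)]; omega
  · simp only [Expr.val, State.setReg_reg, State.setMem_reg, h0]
    simp only [if_false, OfNat.zero_ne_ofNat]
    rw [abs_of_nonneg (by omega)]; omega
  · simp [Expr.Fits]
  · refine ⟨⟨?_, ?_, ?_, ?_⟩, Or.inl ⟨?_, fun _ _ h => h.elim⟩⟩
    · simp [State.setReg_reg, Expr.val]
    · simp [State.setReg_reg, Expr.val, h0]
    · simp [State.setReg_reg, Expr.val, h0]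
    · intro a _
      simp only [State.setReg_mem, State.setMem_mem, Expr.val, Instance.memory,
        Function.update_apply, Int.toNat_zero, hmem]
    · simp [Expr.val]

end

theorem seqList_depth {l : List Program} {k : ℕ} (h : ∀ p ∈ l, p.depth ≤ k) :
    (Program.seqList l).depth ≤ k := by
  induction l with
  | nil => exact Nat.zero_le k
  | cons p l ih =>
    exact max_le (h p (by simp)) (ih fun q hq => h q (by simp [hq]))

/-- A program that runs in time `O(n ^ 3)` and gives correct answers. -/
theorem exists_program : ∃ P : Program, P.depth ≤ 3 ∧ ∀ n : ℕ, 3 ≤ n → ∀ I : Instance n,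
    WP n (I.wordBound 6) P I.initialState (I.IsAnswer 5) := by
  classical
  -- One search program for each valid pattern, chosen before `n` and the instance. Their
  -- concatenation over the finite set of patterns is a single fixed program.
  choose P hdepth hspec using fun φ : {φ : Equiv.Perm Slot // ValidPattern φ} => exists_search φ.2
  refine ⟨.seq prepare (Program.seqList (Finset.univ.toList.map P)), ?_, ?_⟩
  · refine max_le (by decide) (seqList_depth fun p hp => ?_)
    obtain ⟨φ, -, rfl⟩ := List.mem_map.1 hp
    exact hdepth φ
  · intro n hn I
    have key : ∀ (l : List {φ : Equiv.Perm Slot // ValidPattern φ})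
        (D : Equiv.Perm Slot → (Fin 5 → ℕ) → Prop) (s : State), Ready n (I.memory (by omega)) s →
        BestSoFar n (I.memory (by omega)) D s →
        WP n (I.wordBound 6) (Program.seqList (l.map P)) s
          (BestSoFar n (I.memory (by omega)) fun φ p => D φ p ∨ ∃ x ∈ l, φ = x.1) := by
      intro l
      induction l with
      | nil => exact fun D s _ hb => WP.skip (by simpa using hb)
      | cons φ l ih =>
        intro D s hs hb
        refine WP.seq ((hspec φ (I.layout hn) hs hb).mono fun t ht _ _ => ?_)
        refine (ih _ t ht.1 ht.2).mono fun t' ht' _ _ => ht'.mono ?_ fun _ _ => rfl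
        intro φ' p _ h
        simp only [List.mem_cons, exists_eq_or_imp] at h
        tauto
    refine WP.seq ((prepare_spec I hn).mono fun s hs _ _ => ?_)
    refine (key _ _ s hs.1 hs.2).mono fun t ht _ _ => I.isAnswer_of_bestSoFar hn ht ?_
    intro φ p hφ
    exact Or.inr ⟨⟨φ, hφ⟩, by simp, rfl⟩

/-- For `n ≥ 1`, `n + 2 ≤ 3 * n` bounds the time by a constant times `n ^ 3`, which is at most `n ^
(7 / 2)`. -/
theorem time_isBigO {P : Program} (h : P.depth ≤ 3) :
    (fun n => (P.time n : ℝ)) =O[atTop] fun n : ℕ => (n : ℝ) ^ (7 / 2 : ℝ) := by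
  refine IsBigO.of_bound (27 * P.time 0) ?_
  filter_upwards [eventually_ge_atTop 1] with n hn
  have h1 : P.time n ≤ P.time 0 * (3 * n) ^ 3 :=
    (P.time_le n).trans (Nat.mul_le_mul_left _ ((Nat.pow_le_pow_right (by omega) h).trans
      (Nat.pow_le_pow_left (by omega) 3)))
  have h2 : (P.time n : ℝ) ≤ P.time 0 * (3 * n) ^ 3 := by exact_mod_cast h1
  have hn' : (1 : ℝ) ≤ n := by exact_mod_cast hn
  have h3 : (n : ℝ) ^ 3 ≤ (n : ℝ) ^ (7 / 2 : ℝ) := by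
    rw [← Real.rpow_natCast]
    exact Real.rpow_le_rpow_of_exponent_le hn' (by norm_num)
  rw [Real.norm_of_nonneg (by positivity), Real.norm_of_nonneg (by positivity)]
  calc (P.time n : ℝ) ≤ 27 * P.time 0 * (n : ℝ) ^ 3 := by rw [mul_pow] at h2; linarith
    _ ≤ _ := mul_le_mul_of_nonneg_left h3 (by positivity)

end KOpt

theorem mainTheorem11 :
    KOpt.SolvableInTime 5 (fun n : ℕ => (n : ℝ) ^ (7 / 2 : ℝ)) := by
  obtain ⟨P, hdepth, hP⟩ := KOpt.exists_program
  refine ⟨P, 6, fun n => P.time n, KOpt.time_isBigO hdepth, fun n hn I => ?_⟩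
  obtain ⟨m, s, h1, h2, h3⟩ := hP n hn I
  exact ⟨m, s, h1, h2, h3⟩
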